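/- Let $k\in\mathbb N_0\cup\{\infty\}$, let $H$ be a (smooth, real, Hausdorff) Lie group modelled on a Hausdorff real locally convex space $E$, where smoothness and $C^k$-maps are understood in the sense of Bastiani (Keller's $C^k_c$-theory), and let $M$ be a finite-dimensional (Hausdorff) $C^k$-manifold, possibly with boundary. Endow the set $C^k(M,H)$ of all $C^k$-maps $f\colon M\to H$ with pointwise multiplication and with the compact-open $C^k$-topology, i.e. the initial topology with respect to the maps $$T^j\colon C^k(M,H)\to C(T^jM,T^jH),\quad f\mapsto T^jf\qquad (j\in\mathbb N_0,\ j\le k),$$ where $T^jM$, $T^jH$ are the iterated tangent bundles ($T^0M=M$, $T^{j+1}M=T(T^jM)$), $T^jf$ are the iterated tangent maps ($T^0f=f$), and $C(T^jM,T^jH)$ carries the compact-open topology. Then $C^k(M,H)$ is a topological group. A topological group is called complete if every left Cauchy net in it converges, where a net $(x_\alpha)_{\alpha}$ is left Cauchy if for each identity neighbourhood $U$ there is $\gamma$ with $x_\beta^{-1}x_\alpha\in U$ for all $\alpha,\beta\ge\gamma$. If $H$ and $E$ are complete, then also the topological group $C^k(M,H)$ is complete. -/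

import Mathlib

open Set Filter Topology

universe u w

noncomputable section

namespace LCCalculus

/-! ### Differential calculus in real topological vector spaces -/

section Calculus

variable {E F : Type*} [AddCommGroup E] [Module ℝ E] [TopologicalSpace E]
  [AddCommGroup F] [Module ℝ F] [TopologicalSpace F]

/-- `w` is the directional derivative of `f` at `x` in the direction `v`, that is,
`(f (x + t v) - f x) / t → w` as `t → 0`, `t ≠ 0`. -/
def HasDirDeriv (f : E → F) (x v : E) (w : F) : Prop :=
  Tendsto (fun t : ℝ => t⁻¹ • (f (x + t • v) - f x)) (𝓝[≠] 0) (𝓝 w)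

/-- The directional derivative of `f` at `x` in the direction `v` (a junk value if there is none).
-/
def dirDeriv (f : E → F) (x v : E) : F :=
  limUnder (𝓝[≠] (0 : ℝ)) (fun t : ℝ => t⁻¹ • (f (x + t • v) - f x))

/-- The differential `df : s × E → F` of a map `f` on a set `s` with dense interior: at interior
points it consists of the directional derivatives of `f`, at the other points of `s` it is the
continuous extension of these. -/
def differential (f : E → F) (s : Set E) : E × E → F :=
  extendFrom (interior s ×ˢ univ) (fun p => dirDeriv f p.1 p.2)

end Calculus

/-- `f` is a `C^n`-map on `s` (finite `n`) in the sense of Bastiani (Keller's `C^n_c`-maps), where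
`s` is a locally convex subset with dense interior, such as an open subset of `E`
or a relatively open subset of a half-space: `f` is `C^0` if it is continuous, and `f` is `C^(n+1)`
if it is continuous, its directional derivatives exist at interior points and there is
a `C^n`-map `g` on `s × E` extending `(x, v) ↦ df(x, v)`. -/
def CkOnNat : (n : ℕ) → {E F : Type*} → [AddCommGroup E] → [Module ℝ E] → [TopologicalSpace E] →
    [AddCommGroup F] → [Module ℝ F] → [TopologicalSpace F] → (E → F) → Set E → Prop
  | 0, _, _, _, _, _, _, _, _, f, s => ContinuousOn f s
  | n + 1, E, F, _, _, _, _, _, _, f, s =>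
      ContinuousOn f s ∧ ∃ g : E × E → F,
        (∀ x ∈ interior s, ∀ v : E, HasDirDeriv f x v (g (x, v))) ∧ CkOnNat n g (s ×ˢ univ)

/-- `C^k`-maps on `s`, for `k ∈ ℕ₀ ∪ {∞}`. -/
def CkOn {E F : Type*} [AddCommGroup E] [Module ℝ E] [TopologicalSpace E]
    [AddCommGroup F] [Module ℝ F] [TopologicalSpace F] (k : ℕ∞) (f : E → F) (s : Set E) : Prop :=
  ∀ n : ℕ, (n : ℕ∞) ≤ k → CkOnNat n f s

/-! ### Manifolds, tangent bundles, tangent maps -/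

/-- The data of a manifold modelled on the topological vector space `E`: a topological space
with a family of charts `coord i : source i → E` (the values of `coord i` off `source i` are
irrelevant), and for each point a chart around it. There are no laws here; below, only the data
that come from genuine manifolds are used. -/
structure Mfd : Type (u + 1) where
  E : Type u
  [acg : AddCommGroup E]
  [mod : Module ℝ E]
  [topE : TopologicalSpace E]
  carrier : Type u
  [top : TopologicalSpace carrier]
  ι : Type u
  source : ι → Set carrier
  coord : ι → carrier → E
  chartAt : carrier → ι

attribute [instance] Mfd.acg Mfd.mod Mfd.topE Mfd.top

namespace Mfd

/-- The manifold data given by a charted space, with charts taking values in the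
model space `Q`, which is viewed as a part of the vector space `E` by means of `I : Q → E`. -/
abbrev ofCharted (E : Type u) [AddCommGroup E] [Module ℝ E] [TopologicalSpace E]
    {Q : Type u} [TopologicalSpace Q] (I : Q → E)
    (M : Type u) [TopologicalSpace M] [ChartedSpace Q M] : Mfd.{u} where
  E := E
  carrier := M
  ι := atlas Q M
  source := fun φ => φ.1.source
  coord := fun φ x => I (φ.1 x)
  chartAt := fun x => ⟨_root_.chartAt Q x, chart_mem_atlas Q x⟩

/-- The product manifold `M × N`. -/
abbrev prod (M N : Mfd.{u}) : Mfd.{u} where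
  E := M.E × N.E
  carrier := M.carrier × N.carrier
  ι := M.ι × N.ι
  source := fun i => M.source i.1 ×ˢ N.source i.2
  coord := fun i x => (M.coord i.1 x.1, N.coord i.2 x.2)
  chartAt := fun x => (M.chartAt x.1, N.chartAt x.2)

section Maps

variable {M : Mfd.{u}} {N : Mfd.{w}}

/-- The set `U_φ ∩ f⁻¹(U_ψ)`, for `φ` the chart of `M` with index `i` and `ψ` the chart of `N` with
index `j`. -/
def repDom (f : M.carrier → N.carrier) (i : M.ι) (j : N.ι) : Set M.carrier :=
  M.source i ∩ f ⁻¹' N.source j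

/-- The local representative `ψ ∘ f ∘ φ⁻¹` of `f`, defined on
`φ(U_φ ∩ f⁻¹(U_ψ))` (and extended by `0`). -/
def rep (f : M.carrier → N.carrier) (i : M.ι) (j : N.ι) : M.E → N.E :=
  Function.extend (fun x : repDom f i j => M.coord i x.1) (fun x => N.coord j (f x.1)) 0

/-- The domain `φ(U_φ ∩ f⁻¹(U_ψ))` of the local representative `ψ ∘ f ∘ φ⁻¹`. -/
def repSet (f : M.carrier → N.carrier) (i : M.ι) (j : N.ι) : Set M.E :=
  M.coord i '' repDom f i j

/-- `f` is a `C^k`-map between manifolds. -/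
def IsCk (k : ℕ∞) (f : M.carrier → N.carrier) : Prop :=
  Continuous f ∧ ∀ i j, CkOn k (rep f i j) (repSet f i j)

/-- The second component `d(ψ ∘ f ∘ φ⁻¹)(φ(x), v)` of the tangent map, in charts. -/
def dRep (f : M.carrier → N.carrier) (i : M.ι) (j : N.ι) (x : M.carrier) (v : M.E) : N.E :=
  differential (rep f i j) (repSet f i j) (M.coord i x, v)

end Maps

/-- The charts of `M` belong to a `C^k`-atlas: all changes of charts `ψ ∘ φ⁻¹` on `φ(U_φ ∩ U_ψ)`
are `C^k`. -/
def CkAtlas (k : ℕ∞) (M : Mfd.{u}) : Prop :=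
  ∀ i j, CkOn k (rep (M := M) (N := M) id i j) (repSet (M := M) (N := M) id i j)

/-- The chart `Tφ : TU_φ → V_φ × E` of the tangent bundle; see `T`. -/
def tCoord (M : Mfd.{u}) (i : M.ι) (p : M.carrier × M.E) : M.E × M.E :=
  (M.coord i p.1, dRep (M := M) (N := M) id (M.chartAt p.1) i p.1 p.2)

/-- The tangent bundle `TM`. The tangent space at `x` is identified with `E` by means of the
preferred chart `φ_x` around `x`, so that the chart `φ` of `M` gives
the chart `Tφ : (x, v) ↦ (φ(x), d(φ ∘ φ_x⁻¹)(φ_x(x), v))` of `TM`. A subset of `TM`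
is open if and only if, for each `φ`, its intersection with `TU_φ` is open in the topology
which makes `Tφ` a homeomorphism onto its image in `E × E`. -/
def T (M : Mfd.{u}) : Mfd.{u} where
  E := M.E × M.E
  carrier := M.carrier × M.E
  top := ⨆ i : M.ι, TopologicalSpace.coinduced
    (Subtype.val : {p : M.carrier × M.E // p.1 ∈ M.source i} → M.carrier × M.E)
    (TopologicalSpace.induced (fun p => tCoord M i p.1) instTopologicalSpaceProd)
  ι := M.ι
  source := fun i => {p | p.1 ∈ M.source i}
  coord := fun i p => tCoord M i p
  chartAt := fun p => M.chartAt p.1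

/-- The tangent map `Tf : TM → TN`. -/
def tMap {M : Mfd.{u}} {N : Mfd.{w}} (f : M.carrier → N.carrier) :
    (T M).carrier → (T N).carrier :=
  fun p => (f p.1, dRep f (M.chartAt p.1) (N.chartAt (f p.1)) p.1 p.2)

/-- The iterated tangent bundle `T^j M`. -/
def iterT : ℕ → Mfd.{u} → Mfd.{u}
  | 0, M => M
  | j + 1, M => iterT j (T M)

/-- The iterated tangent map `T^j f : T^j M → T^j N`. -/
def iterTMap : (j : ℕ) → {M : Mfd.{u}} → {N : Mfd.{w}} → (M.carrier → N.carrier) →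
    (iterT j M).carrier → (iterT j N).carrier
  | 0, _, _, f => f
  | j + 1, M, N, f => iterTMap j (M := T M) (N := T N) (tMap f)

/-- The topology on a set of maps `X → Y` generated by the sets `{f | f(K) ⊆ U}`, for `K` compact
and `U` open. On continuous maps, this is the compact-open topology. -/
@[reducible]
def compactOpenTopology (X Y : Type*) [TopologicalSpace X] [TopologicalSpace Y] :
    TopologicalSpace (X → Y) :=
  TopologicalSpace.generateFrom
    (image2 (fun K U => {f : X → Y | MapsTo f K U}) {K | IsCompact K} {U | IsOpen U})

/-- The compact-open `C^k`-topology: the initial topology with respect to the maps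
`f ↦ T^j f ∈ C(T^j M, T^j N)` for `j ∈ ℕ₀`, `j ≤ k`. It is defined for all maps here, and will be
restricted to `C^k`-maps. -/
@[reducible]
def ckTopology (k : ℕ∞) (M : Mfd.{u}) (N : Mfd.{w}) :
    TopologicalSpace (M.carrier → N.carrier) :=
  ⨅ (j : ℕ) (_ : (j : ℕ∞) ≤ k), TopologicalSpace.induced (iterTMap j)
    (compactOpenTopology (iterT j M).carrier (iterT j N).carrier)

end Mfd

/-- `H` is a (smooth, real) Lie group modelled on the locally convex space `F`: the charts
`H ⊇ U → V ⊆ F` form a smooth atlas, and multiplication and inversion are smooth. -/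
structure IsLieGroup (F : Type w) [AddCommGroup F] [Module ℝ F] [TopologicalSpace F]
    (H : Type w) [Group H] [TopologicalSpace H] [ChartedSpace F H] : Prop where
  smooth_atlas : (Mfd.ofCharted F id H).CkAtlas ⊤
  smooth_mul : Mfd.IsCk (M := (Mfd.ofCharted F id H).prod (Mfd.ofCharted F id H))
    (N := Mfd.ofCharted F id H) ⊤ (fun p : H × H => p.1 * p.2)
  smooth_inv : Mfd.IsCk (M := Mfd.ofCharted F id H) (N := Mfd.ofCharted F id H) ⊤
    (fun x : H => x⁻¹)

/-- A topological group is complete if it is complete in its left uniformity, the entourages of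
which are given by `x⁻¹ y ∈ U` for `U` an identity neighbourhood. -/
def IsCompleteGroup (G : Type*) [Group G] [TopologicalSpace G] [IsTopologicalGroup G] : Prop :=
  @CompleteSpace G (IsTopologicalGroup.leftUniformSpace G)

end LCCalculus

end

-- The tangent functor preserves products, so applying it to the group laws turns each `T^j H` into
-- a Lie group and each `f ↦ T^j f` into a homomorphism from `C^k(M,H)` to `C(T^j M, T^j H)`. The
-- compact-open `C^k`-topology is thus initial with respect to homomorphisms into topological
-- groups, hence a group topology, and completeness splits into two questions.
--
-- Do the limits exist? `TH` is an extension of `H` by the additive group of the model space, with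
-- the continuous zero section as a cross-section. A left Cauchy filter on `TH` therefore converges
-- if both `H` and the model space are complete (`cauchyConverges_T`), and this can be iterated
-- because the model space of `TH` is a product of two complete spaces. Since `M` is
-- finite-dimensional, `T^j M` is locally compact, and `C(T^j M, T^j H)` is complete
-- (`cauchyConverges_continuousMap`). A Cauchy filter on `C^k(M,H)` thus yields limits `g j` of the
-- maps `T^j f`.
--
-- Is `g j = T^j (g 0)`? By local compactness, compact-open convergence implies continuous
-- convergence (`ContConv`), which can be tested point by point in charts. There the mean value
-- theorem, in the form that difference quotients lie in any closed convex set containing the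
-- derivatives, shows that a limit of maps is differentiable if the derivatives converge
-- (`hasDirDeriv_of_tendsto`). Induction on the order finishes the argument (`isCn_of_contConv`).
--
-- Boundary points are handled through admissible sets. There, interior directional derivatives with
-- a continuous extension already force convergence of all difference quotients with moving base
-- point and direction (`isC1_of_hasDirDeriv`). In this strict form the chain rule and the
-- uniqueness of differentials hold up to the boundary.

universe v

noncomputable section

namespace LCCalculus

/-! ### Calculus on admissible sets -/

section Admissible

variable {E F G : Type*} [AddCommGroup E] [Module ℝ E] [TopologicalSpace E]
  [AddCommGroup F] [Module ℝ F] [TopologicalSpace F]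
  [AddCommGroup G] [Module ℝ G] [TopologicalSpace G]

/-- The intersection of an open set and a convex set with non-empty interior. -/
def Adm (s : Set E) : Prop :=
  ∃ O C : Set E, IsOpen O ∧ Convex ℝ C ∧ (interior C).Nonempty ∧ s = O ∩ C

theorem Adm.inter_open {s O : Set E} (hs : Adm s) (hO : IsOpen O) : Adm (O ∩ s) := by
  obtain ⟨O', C, h1, h2, h3, rfl⟩ := hs
  exact ⟨O ∩ O', C, hO.inter h1, h2, h3, by rw [inter_assoc]⟩

theorem IsOpen.adm {s : Set E} (hs : IsOpen s) : Adm s :=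
  ⟨s, univ, hs, convex_univ, by simp, by simp⟩

theorem Adm.prod {s : Set E} {t : Set F} (hs : Adm s) (ht : Adm t) : Adm (s ×ˢ t) := by
  obtain ⟨O, C, h1, h2, h3, rfl⟩ := hs
  obtain ⟨O', C', h1', h2', h3', rfl⟩ := ht
  refine ⟨O ×ˢ O', C ×ˢ C', h1.prod h1', h2.prod h2', ?_, prod_inter_prod.symm⟩
  rw [interior_prod_eq]
  exact h3.prod h3'

theorem Adm.prod_univ {s : Set E} (hs : Adm s) : Adm (s ×ˢ (univ : Set F)) :=
  hs.prod (IsOpen.adm isOpen_univ)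

theorem Adm.subset_closure_interior [IsTopologicalAddGroup E] [ContinuousSMul ℝ E]
    {s : Set E} (hs : Adm s) : s ⊆ closure (interior s) := by
  obtain ⟨O, C, h1, h2, h3, rfl⟩ := hs
  rintro x ⟨hxO, hxC⟩
  have h : x ∈ closure (interior C) := by
    rw [h2.closure_interior_eq_closure_of_nonempty_interior h3]
    exact subset_closure hxC
  rw [interior_inter, h1.interior_eq]
  exact h1.inter_closure ⟨hxO, h⟩

/-- `w` is the limit of the difference quotients `t⁻¹ (f (x' + t v') - f x')` as
`(x', v', t) → (x, v, 0)`, where `x'` and `x' + t v'` stay in `s`. -/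
def HasD (f : E → F) (s : Set E) (x v : E) (w : F) : Prop :=
  Tendsto (fun q : E × E × ℝ => q.2.2⁻¹ • (f (q.1 + q.2.2 • q.2.1) - f q.1))
    (𝓝[{q | q.1 ∈ s ∧ q.1 + q.2.2 • q.2.1 ∈ s ∧ q.2.2 ≠ 0}] (x, v, 0)) (𝓝 w)

theorem HasD.mono {f : E → F} {s t : Set E} {x v : E} {w : F} (h : HasD f t x v w) (hst : s ⊆ t) :
    HasD f s x v w :=
  h.mono_left (nhdsWithin_mono _ fun _ hq => ⟨hst hq.1, hst hq.2.1, hq.2.2⟩)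

theorem HasD.congr {f f' : E → F} {s : Set E} {x v : E} {w : F} (h : HasD f s x v w)
    (hf : EqOn f f' s) : HasD f' s x v w :=
  Tendsto.congr' (eventually_mem_nhdsWithin.mono fun q hq => by simp [hf hq.1, hf hq.2.1]) h

theorem HasD.hasDirDeriv [IsTopologicalAddGroup E] [ContinuousSMul ℝ E] {f : E → F} {s : Set E}
    {x v : E} {w : F} (h : HasD f s x v w) (hx : x ∈ interior s) : HasDirDeriv f x v w := by
  have hc : Continuous fun t : ℝ => x + t • v := by fun_prop
  have h0 : Tendsto (fun t : ℝ => x + t • v) (𝓝 0) (𝓝 x) := by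
    simpa using hc.tendsto 0
  refine h.comp (f := fun t : ℝ => (x, v, t)) (tendsto_nhdsWithin_iff.2 ⟨?_, ?_⟩)
  · exact ((Continuous.tendsto (by fun_prop) _).mono_left nhdsWithin_le_nhds)
  · filter_upwards [eventually_mem_nhdsWithin,
      (h0.eventually (mem_interior_iff_mem_nhds.1 hx)).filter_mono nhdsWithin_le_nhds] with t ht hts
    exact ⟨interior_subset hx, hts, ht⟩

theorem tendsto_lineMap_nhds [IsTopologicalAddGroup E] [ContinuousSMul ℝ E] (x v : E) :
    Tendsto (fun q : E × E × ℝ => q.1 + q.2.2 • q.2.1) (𝓝 (x, v, 0)) (𝓝 x) := by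
  have hc : Continuous fun q : E × E × ℝ => q.1 + q.2.2 • q.2.1 := by fun_prop
  simpa using hc.tendsto (x, v, 0)

/-- A difference quotient of `h ∘ f` is one of `h`, based at `f q.1` and taken in the direction of
the difference quotient of `f`. This is why `HasD` lets base point and direction vary. -/
theorem HasD.comp [IsTopologicalAddGroup E] [ContinuousSMul ℝ E]
    {f : E → F} {s : Set E} {x v : E} {w : F} {h : F → G} {r : Set F} {z : G}
    (hf : HasD f s x v w) (hfc : ContinuousWithinAt f s x) (hh : HasD h r (f x) w z)
    (hm : MapsTo f s r) : HasD (h ∘ f) s x v z := by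
  set A : Set (E × E × ℝ) := {q | q.1 ∈ s ∧ q.1 + q.2.2 • q.2.1 ∈ s ∧ q.2.2 ≠ 0} with hA
  have h1 : Tendsto (fun q : E × E × ℝ => (f q.1, q.2.2⁻¹ • (f (q.1 + q.2.2 • q.2.1) - f q.1),
      q.2.2)) (𝓝[A] (x, v, 0)) (𝓝 (f x, w, 0)) := by
    refine Tendsto.prodMk_nhds ?_ (Tendsto.prodMk_nhds hf ?_)
    · refine hfc.tendsto.comp (tendsto_nhdsWithin_iff.2 ⟨?_, ?_⟩)
      · exact (continuous_fst.tendsto _).mono_left nhdsWithin_le_nhds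
      · filter_upwards [eventually_mem_nhdsWithin] with q hq using hq.1
    · exact ((Continuous.tendsto (by fun_prop) _).mono_left nhdsWithin_le_nhds)
  have key : ∀ q ∈ A, f q.1 + q.2.2 • (q.2.2⁻¹ • (f (q.1 + q.2.2 • q.2.1) - f q.1)) =
      f (q.1 + q.2.2 • q.2.1) := by
    rintro q ⟨-, -, h3⟩
    rw [smul_inv_smul₀ h3]
    abel
  refine (Tendsto.comp hh (tendsto_nhdsWithin_iff.2 ⟨h1, ?_⟩)).congr' ?_
  · filter_upwards [eventually_mem_nhdsWithin] with q hq
    refine ⟨hm hq.1, ?_, hq.2.2⟩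
    rw [key q hq]
    exact hm hq.2.1
  · filter_upwards [eventually_mem_nhdsWithin] with q hq
    simp only [Function.comp]
    rw [key q hq]

/-- `f` is `C¹` on `s` in the strict sense, with differential `g`. -/
structure IsC1 (f : E → F) (g : E × E → F) (s : Set E) : Prop where
  continuousOn : ContinuousOn f s
  continuousOn_deriv : ContinuousOn g (s ×ˢ univ)
  hasD : ∀ x ∈ s, ∀ v, HasD f s x v (g (x, v))

theorem IsC1.mono {f : E → F} {g : E × E → F} {s t : Set E} (h : IsC1 f g t) (hst : s ⊆ t) :
    IsC1 f g s :=
  ⟨h.1.mono hst, h.2.mono (prod_mono hst subset_rfl), fun x hx v => (h.3 x (hst hx) v).mono hst⟩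

theorem IsC1.congr {f f' : E → F} {g : E × E → F} {s : Set E} (h : IsC1 f g s)
    (hf : EqOn f f' s) : IsC1 f' g s :=
  ⟨h.1.congr hf.symm, h.2, fun x hx v => (h.3 x hx v).congr hf⟩

theorem IsC1.comp [IsTopologicalAddGroup E] [ContinuousSMul ℝ E]
    {f : E → F} {g : E × E → F} {s : Set E} {h : F → G} {k : F × F → G} {r : Set F}
    (hh : IsC1 h k r) (hf : IsC1 f g s) (hm : MapsTo f s r) :
    IsC1 (h ∘ f) (fun p => k (f p.1, g p)) s := by
  refine ⟨hh.1.comp hf.1 hm, ?_, fun x hx v => (hf.3 x hx v).comp (hf.1 x hx)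
    (hh.3 _ (hm hx) _) hm⟩
  refine hh.2.comp (f := fun p : E × E => (f p.1, g p)) (ContinuousOn.prodMk ?_ hf.2)
    (fun p hp => ⟨hm hp.1, trivial⟩)
  exact hf.1.comp continuousOn_fst (fun p hp => hp.1)

/-- The interior is dense in an admissible set, so a continuous `g` is determined by the directional
derivatives at interior points. -/
theorem IsC1.differential_eq [IsTopologicalAddGroup E] [ContinuousSMul ℝ E] [T2Space F]
    {f : E → F} {g : E × E → F} {s : Set E} (hs : Adm s) (h : IsC1 f g s) :
    EqOn (differential f s) g (s ×ˢ univ) := by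
  rintro ⟨x, v⟩ ⟨hx, -⟩
  refine extendFrom_eq ?_ ?_
  · rw [closure_prod_eq]
    exact ⟨hs.subset_closure_interior hx, subset_closure trivial⟩
  · refine ((h.2 (x, v) ⟨hx, trivial⟩).mono
      (prod_mono interior_subset subset_rfl)).tendsto.congr' ?_
    filter_upwards [eventually_mem_nhdsWithin] with p hp
    have : Nonempty F := ⟨0⟩
    exact (((h.3 p.1 (interior_subset hp.1) p.2).hasDirDeriv hp.1).limUnder_eq).symm

theorem IsC1.congr_deriv {f : E → F} {g g' : E × E → F} {s : Set E} (h : IsC1 f g s)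
    (hg : EqOn g g' (s ×ˢ univ)) : IsC1 f g' s :=
  ⟨h.1, h.2.congr hg.symm, fun x hx v => by rw [← hg ⟨hx, trivial⟩]; exact h.3 x hx v⟩

theorem IsC1.isC1_differential [IsTopologicalAddGroup E] [ContinuousSMul ℝ E] [T2Space F]
    {f : E → F} {g : E × E → F} {s : Set E} (hs : Adm s) (h : IsC1 f g s) :
    IsC1 f (differential f s) s :=
  h.congr_deriv (h.differential_eq hs).symm

theorem IsC1.eqOn [IsTopologicalAddGroup E] [ContinuousSMul ℝ E] [T2Space F]
    {f : E → F} {g g' : E × E → F} {s : Set E} (hs : Adm s) (h : IsC1 f g s) (h' : IsC1 f g' s) :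
    EqOn g g' (s ×ˢ univ) :=
  (h.differential_eq hs).symm.trans (h'.differential_eq hs)

/-- At an interior point `y`, a step along `v + w` is a step along `v` followed by one along `w`
from the moving base point `y + t • v`, which the strict derivative controls. Density of the
interior gives the remaining points. -/
theorem IsC1.add_deriv [IsTopologicalAddGroup E] [ContinuousSMul ℝ E]
    [IsTopologicalAddGroup F] [T2Space F]
    {f : E → F} {g : E × E → F} {s : Set E} (hs : Adm s) (h : IsC1 f g s) {x : E} (hx : x ∈ s)
    (v w : E) : g (x, v + w) = g (x, v) + g (x, w) := by
  have main : ∀ y ∈ interior s, g (y, v + w) = g (y, v) + g (y, w) := by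
    intro y hy
    have hys := interior_subset hy
    have h1 : HasDirDeriv f y (v + w) (g (y, v + w)) := (h.3 y hys _).hasDirDeriv hy
    have h2 : HasDirDeriv f y v (g (y, v)) := (h.3 y hys _).hasDirDeriv hy
    have hc : Continuous fun t : ℝ => (y + t • v, w, t) := by fun_prop
    have hc' : Continuous fun t : ℝ => y + t • v + t • w := by fun_prop
    have h0 : Tendsto (fun t : ℝ => (y + t • v, w, t)) (𝓝 0) (𝓝 (y, w, 0)) := by
      simpa using hc.tendsto 0
    have h0' : Tendsto (fun t : ℝ => y + t • v + t • w) (𝓝 0) (𝓝 y) := by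
      simpa using hc'.tendsto 0
    have h3 := Tendsto.comp (h.3 y hys w) (f := fun t : ℝ => (y + t • v, w, t)) (x := 𝓝[≠] 0) (by
      refine tendsto_nhdsWithin_iff.2 ⟨h0.mono_left nhdsWithin_le_nhds, ?_⟩
      filter_upwards [eventually_mem_nhdsWithin,
        ((continuous_fst.tendsto _).comp h0 |>.eventually
          (mem_interior_iff_mem_nhds.1 hy)).filter_mono nhdsWithin_le_nhds,
        (h0'.eventually (mem_interior_iff_mem_nhds.1 hy)).filter_mono nhdsWithin_le_nhds]
        with t ht h1 h2
      exact ⟨h1, h2, ht⟩)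
    refine tendsto_nhds_unique h1 ((h2.add h3).congr fun t => ?_)
    simp only [Function.comp]
    rw [← smul_add, smul_add t v w, add_assoc y]
    congr 1
    abel
  have : (𝓝[interior s] x).NeBot :=
    mem_closure_iff_nhdsWithin_neBot.1 (hs.subset_closure_interior hx)
  have lim : ∀ u : E, Tendsto (fun y => g (y, u)) (𝓝[interior s] x) (𝓝 (g (x, u))) := by
    intro u
    refine (h.2 (x, u) ⟨hx, trivial⟩).tendsto.comp (f := fun y => (y, u))
      (tendsto_nhdsWithin_iff.2 ⟨?_, ?_⟩)
    · exact (Continuous.tendsto (by fun_prop) x).mono_left nhdsWithin_le_nhds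
    · filter_upwards [eventually_mem_nhdsWithin] with y hy using ⟨interior_subset hy, trivial⟩
  refine tendsto_nhds_unique (lim (v + w)) (((lim v).add (lim w)).congr' ?_)
  filter_upwards [eventually_mem_nhdsWithin] with y hy using (main y hy).symm

theorem IsC1.deriv_zero [IsTopologicalAddGroup E] [ContinuousSMul ℝ E]
    [IsTopologicalAddGroup F] [T2Space F]
    {f : E → F} {g : E × E → F} {s : Set E} (hs : Adm s) (h : IsC1 f g s) {x : E} (hx : x ∈ s) :
    g (x, 0) = 0 := by
  simpa using h.add_deriv hs hx 0 0

theorem IsC1.prodMk {f : E → F} {g : E × E → F} {f' : E → G} {g' : E × E → G} {s : Set E}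
    (h : IsC1 f g s) (h' : IsC1 f' g' s) :
    IsC1 (fun x => (f x, f' x)) (fun p => (g p, g' p)) s :=
  ⟨h.1.prodMk h'.1, h.2.prodMk h'.2, fun x hx v => (h.3 x hx v).prodMk_nhds (h'.3 x hx v)⟩

theorem isC1_clm [IsTopologicalAddGroup E] [ContinuousSMul ℝ E] (L : E →L[ℝ] F) (s : Set E) :
    IsC1 L (fun p => L p.2) s := by
  refine ⟨L.continuous.continuousOn, by fun_prop, fun x _ v => ?_⟩
  have : Tendsto (fun q : E × E × ℝ => L q.2.1)
    (𝓝[{q | q.1 ∈ s ∧ q.1 + q.2.2 • q.2.1 ∈ s ∧ q.2.2 ≠ 0}] (x, v, 0)) (𝓝 (L v)) :=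
    (Continuous.tendsto (by fun_prop) (x, v, (0 : ℝ))).mono_left nhdsWithin_le_nhds
  refine this.congr' ?_
  filter_upwards [eventually_mem_nhdsWithin] with q hq
  simp [inv_smul_smul₀ hq.2.2]

theorem isC1_const (c : F) (s : Set E) :
    IsC1 (fun _ => c) (fun _ => 0) s := by
  refine ⟨continuousOn_const, continuousOn_const, fun x _ v => ?_⟩
  simp [HasD, tendsto_const_nhds]

end Admissible

/-! ### The mean value theorem in locally convex spaces -/

section MeanValue

variable {E F : Type*} [AddCommGroup E] [Module ℝ E]
  [AddCommGroup F] [Module ℝ F] [TopologicalSpace F]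
  [IsTopologicalAddGroup F] [ContinuousSMul ℝ F] [LocallyConvexSpace ℝ F]

/-- If the quotient were outside `K`, Hahn–Banach would separate it from `K` by a functional `l`;
the scalar mean value theorem for `l ∘ f` along the segment contradicts this. -/
theorem mean_value_mem {f : E → F} {a w : E} {c : ℝ} (hc : c ≠ 0) {K : Set F}
    (hK : Convex ℝ K) (hKc : IsClosed K)
    (hd : ∀ r ∈ Icc (0 : ℝ) 1, ∃ z ∈ K, HasDirDeriv f (a + (r * c) • w) w z) :
    c⁻¹ • (f (a + c • w) - f a) ∈ K := by
  by_contra hn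
  obtain ⟨l, b, hl, hb⟩ := geometric_hahn_banach_closed_point hK hKc hn
  choose! z hzK hz using hd
  set ψ : ℝ → ℝ := fun r => c⁻¹ * l (f (a + (r * c) • w)) with hψ
  have hder : ∀ r ∈ Icc (0 : ℝ) 1, HasDerivAt ψ (l (z r)) r := by
    intro r hr
    rw [hasDerivAt_iff_tendsto_slope_zero]
    have h1 : Tendsto (fun h : ℝ => h * c) (𝓝[≠] 0) (𝓝[≠] 0) := by
      refine tendsto_nhdsWithin_iff.2 ⟨?_, ?_⟩
      · have : Continuous fun h : ℝ => h * c := by fun_prop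
        simpa using (this.tendsto 0).mono_left nhdsWithin_le_nhds
      · filter_upwards [eventually_mem_nhdsWithin] with h hh
        exact mul_ne_zero hh hc
    have h2 := ((l.continuous.tendsto _).comp (hz r hr)).comp h1
    refine h2.congr fun h => ?_
    simp only [Function.comp, hψ, map_smul, map_sub, smul_eq_mul, mul_inv]
    rw [add_assoc, ← add_smul, ← add_mul]
    ring
  obtain ⟨r, hr, he⟩ := exists_hasDerivAt_eq_slope ψ (fun r => l (z r)) zero_lt_one
    (fun r hr => (hder r hr).continuousAt.continuousWithinAt)
    (fun r hr => hder r (Ioo_subset_Icc_self hr))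
  have h3 := hl _ (hzK r (Ioo_subset_Icc_self hr))
  have h4 : l (c⁻¹ • (f (a + c • w) - f a)) = ψ 1 - ψ 0 := by
    simp [hψ, mul_sub]
  rw [h4] at hb
  simp only [sub_zero, div_one] at he
  linarith

theorem exists_closed_convex_nhds {y : F} {U : Set F} (hU : U ∈ 𝓝 y) :
    ∃ K ∈ 𝓝 y, K ⊆ U ∧ IsClosed K ∧ Convex ℝ K := by
  obtain ⟨V, hV, hVc, hVU⟩ := exists_mem_nhds_isClosed_subset hU
  obtain ⟨C, hC, hCc, hCV⟩ := (locallyConvexSpace_iff_exists_convex_subset ℝ F).1 inferInstance y V hV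
  exact ⟨closure C, mem_of_superset hC subset_closure, (closure_minimal hCV hVc).trans hVU,
    isClosed_closure, hCc.closure⟩

theorem tendsto_nhds_of_closed_convex {α : Type*} {l : Filter α} {f : α → F} {y : F}
    (h : ∀ K ∈ 𝓝 y, IsClosed K → Convex ℝ K → ∀ᶠ a in l, f a ∈ K) : Tendsto f l (𝓝 y) := by
  intro U hU
  obtain ⟨K, hK, hKU, hKc, hKv⟩ := exists_closed_convex_nhds hU
  exact (h K hK hKc hKv).mono fun a ha => hKU ha

variable [TopologicalSpace E] [IsTopologicalAddGroup E] [ContinuousSMul ℝ E]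

/-- The segment may run in the boundary, where nothing is known about derivatives. Contracting it by
the factor `1 - e` towards an interior point moves it into the interior and keeps its direction `w`;
continuity of `f` and closedness of `K` allow `e → 0`. -/
theorem mean_value_mem_of_convex {f : E → F} {D : Set E} (hD : Convex ℝ D)
    (hDi : (interior D).Nonempty) (hf : ContinuousOn f D) {K : Set F} (hK : Convex ℝ K)
    (hKc : IsClosed K) {w : E} (hd : ∀ y ∈ interior D, ∃ z ∈ K, HasDirDeriv f y w z)
    {x : E} {t : ℝ} (ht : t ≠ 0) (hx : x ∈ D) (hxt : x + t • w ∈ D) :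
    t⁻¹ • (f (x + t • w) - f x) ∈ K := by
  obtain ⟨y, hy⟩ := hDi
  have hlim : ∀ a ∈ D, Tendsto (fun e : ℝ => f ((1 - e) • a + e • y)) (𝓝[>] 0) (𝓝 (f a)) ∧
      ∀ e ∈ Ioo (0 : ℝ) 1, (1 - e) • a + e • y ∈ interior D := by
    intro a ha
    have h2 : ∀ e ∈ Ioo (0 : ℝ) 1, (1 - e) • a + e • y ∈ interior D := fun e he =>
      hD.combo_self_interior_mem_interior ha hy (by linarith [he.2]) he.1 (by ring)
    refine ⟨(hf a ha).tendsto.comp (tendsto_nhdsWithin_iff.2 ⟨?_, ?_⟩), h2⟩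
    · have hc : Continuous fun e : ℝ => (1 - e) • a + e • y := by fun_prop
      simpa using (hc.tendsto 0).mono_left nhdsWithin_le_nhds
    · filter_upwards [Ioo_mem_nhdsGT (zero_lt_one' ℝ)] with e he using interior_subset (h2 e he)
  have hlim' : Tendsto (fun e : ℝ => ((1 - e) * t)⁻¹ •
      (f ((1 - e) • (x + t • w) + e • y) - f ((1 - e) • x + e • y))) (𝓝[>] 0)
      (𝓝 (t⁻¹ • (f (x + t • w) - f x))) := by
    refine Tendsto.smul ?_ ((hlim _ hxt).1.sub (hlim _ hx).1)
    have hc : Tendsto (fun e : ℝ => (1 - e) * t) (𝓝[>] 0) (𝓝 t) := by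
      have hc : Continuous fun e : ℝ => (1 - e) * t := by fun_prop
      simpa using (hc.tendsto 0).mono_left nhdsWithin_le_nhds
    exact hc.inv₀ ht
  refine hKc.mem_of_tendsto hlim' ?_
  filter_upwards [Ioo_mem_nhdsGT (zero_lt_one' ℝ)] with e he
  have h1 := (hlim _ hx).2 e he
  have h2 := (hlim _ hxt).2 e he
  have h3 : (1 - e) • (x + t • w) + e • y = (1 - e) • x + e • y + ((1 - e) * t) • w := by
    rw [smul_add, smul_smul]
    abel
  rw [h3] at h2 ⊢
  refine mean_value_mem (mul_ne_zero (by linarith [he.2]) ht) hK hKc fun r hr => hd _ ?_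
  have := hD.interior h1 h2 (sub_nonneg.2 hr.2) hr.1 (by ring)
  convert this using 1
  rw [smul_add r, smul_smul, ← add_assoc, ← add_smul]
  simp

/-- Near `x` the set `s` contains the convex set `D = B ∩ C`, on which `g` takes values in `K` for
directions close to `v`. The mean value theorem on `D` then puts all nearby difference quotients
into `K`. -/
theorem isC1_of_hasDirDeriv [LocallyConvexSpace ℝ E]
    {f : E → F} {g : E × E → F} {s : Set E} (hs : Adm s) (hf : ContinuousOn f s)
    (hg : ContinuousOn g (s ×ˢ univ)) (hd : ∀ x ∈ interior s, ∀ v, HasDirDeriv f x v (g (x, v))) :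
    IsC1 f g s := by
  refine ⟨hf, hg, fun x hx v => tendsto_nhds_of_closed_convex fun K hK hKc hKv => ?_⟩
  obtain ⟨P, hP, V, hV, hPV⟩ := mem_nhdsWithin_prod_iff.1 (hg (x, v) ⟨hx, trivial⟩ hK)
  rw [nhdsWithin_univ] at hV
  obtain ⟨O', hO', hxO', hOP⟩ := mem_nhdsWithin.1 hP
  obtain ⟨O, C, hO, hC, hCi, rfl⟩ := hs
  obtain ⟨B, hB, hBc, hBO⟩ := (locallyConvexSpace_iff_exists_convex_subset ℝ E).1 inferInstance x
    (O' ∩ O) ((hO'.inter hO).mem_nhds ⟨hxO', hx.1⟩)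
  have hDs : B ∩ C ⊆ O ∩ C := inter_subset_inter_left _ (hBO.trans inter_subset_right)
  have hDi : (interior (B ∩ C)).Nonempty := by
    have h : x ∈ closure (interior C) := by
      rw [hC.closure_interior_eq_closure_of_nonempty_interior hCi]
      exact subset_closure hx.2
    rw [interior_inter]
    exact mem_closure_iff_nhds.1 h _ (interior_mem_nhds.2 hB)
  have hB' : ∀ᶠ q in 𝓝 (x, v, (0 : ℝ)), q.1 ∈ B ∧ q.1 + q.2.2 • q.2.1 ∈ B ∧ q.2.1 ∈ V := by
    refine ((continuous_fst.tendsto (x, v, (0 : ℝ))).eventually hB).and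
      (((tendsto_lineMap_nhds x v).eventually hB).and ?_)
    have hc : Continuous fun q : E × E × ℝ => q.2.1 := by fun_prop
    exact (hc.tendsto (x, v, (0 : ℝ))).eventually hV
  filter_upwards [eventually_mem_nhdsWithin, hB'.filter_mono nhdsWithin_le_nhds] with q hq hq'
  refine mean_value_mem_of_convex (hBc.inter hC) hDi (hf.mono hDs) hKv hKc (fun y hy => ?_)
    hq.2.2 ⟨hq'.1, hq.1.2⟩ ⟨hq'.2.1, hq.2.1.2⟩
  refine ⟨_, ?_, hd y (interior_mono hDs hy) _⟩
  have hyD := interior_subset hy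
  exact hPV (show (y, q.2.1) ∈ P ×ˢ V from ⟨hOP ⟨(hBO hyD.1).1, hDs hyD⟩, hq'.2.2⟩)

/-- The mean value theorem puts the quotients of `f' a` into `K` for all small `t`, with a bound on
`t` independent of `a ∈ A`. Hence the limit over `a` may be taken first, with `t` fixed. -/
theorem hasDirDeriv_of_tendsto {α : Type*} {l : Filter α} [l.NeBot] {f' g' : α → E → F} {f : E → F}
    {x v : E} {w : F} (hf : ∀ᶠ y in 𝓝 x, Tendsto (fun a => f' a y) l (𝓝 (f y)))
    (hd : ∀ᶠ p in l ×ˢ 𝓝 x, HasDirDeriv (f' p.1) p.2 v (g' p.1 p.2))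
    (hg : Tendsto (fun p : α × E => g' p.1 p.2) (l ×ˢ 𝓝 x) (𝓝 w)) : HasDirDeriv f x v w := by
  refine tendsto_nhds_of_closed_convex fun K hK hKc hKv => ?_
  obtain ⟨A, hA, O, hO, hAO⟩ := mem_prod_iff.1 ((hg.eventually hK).and hd)
  have hc : Continuous fun t : ℝ => x + t • v := by fun_prop
  have h0 : Tendsto (fun t : ℝ => x + t • v) (𝓝 0) (𝓝 x) := by
    simpa using hc.tendsto 0
  obtain ⟨δ, hδ, hball⟩ := Metric.mem_nhds_iff.1 (h0 hO)
  filter_upwards [eventually_mem_nhdsWithin, (h0.eventually hf).filter_mono nhdsWithin_le_nhds,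
    nhdsWithin_le_nhds (Metric.ball_mem_nhds (0 : ℝ) hδ)] with t ht hft htδ
  refine hKc.mem_of_tendsto ((hft.sub hf.self_of_nhds).const_smul t⁻¹) ?_
  filter_upwards [hA] with a ha
  refine mean_value_mem ht hKv hKc fun r hr => ?_
  have h1 : x + (r * t) • v ∈ O := by
    refine hball ?_
    simp only [Metric.mem_ball, dist_zero_right, Real.norm_eq_abs, abs_mul] at htδ ⊢
    rw [abs_of_nonneg hr.1]
    exact (mul_le_of_le_one_left (abs_nonneg t) hr.2).trans_lt htδ
  exact ⟨_, hAO (mk_mem_prod ha h1)⟩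

end MeanValue

/-! ### `C^n`-maps on admissible sets -/

section CkOnNat

variable {E F G : Type*} [AddCommGroup E] [Module ℝ E] [TopologicalSpace E]
  [AddCommGroup F] [Module ℝ F] [TopologicalSpace F]
  [AddCommGroup G] [Module ℝ G] [TopologicalSpace G]

theorem CkOnNat.continuousOn {n : ℕ} {f : E → F} {s : Set E} (h : CkOnNat n f s) :
    ContinuousOn f s := by
  cases n with
  | zero => exact h
  | succ n => exact h.1

theorem CkOnNat.of_succ {n : ℕ} : ∀ {E F : Type*} [AddCommGroup E] [Module ℝ E]
    [TopologicalSpace E] [AddCommGroup F] [Module ℝ F] [TopologicalSpace F] {f : E → F} {s : Set E},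
    CkOnNat (n + 1) f s → CkOnNat n f s := by
  induction n with
  | zero => exact fun h => h.1
  | succ n ih =>
    rintro E F _ _ _ _ _ _ f s ⟨hf, g, hg, hgn⟩
    exact ⟨hf, g, hg, ih hgn⟩

theorem CkOnNat.of_le {n m : ℕ} (hnm : m ≤ n) {f : E → F} {s : Set E} (h : CkOnNat n f s) :
    CkOnNat m f s := by
  induction hnm with
  | refl => exact h
  | step _ ih => exact ih h.of_succ

theorem HasDirDeriv.congr [IsTopologicalAddGroup E] [ContinuousSMul ℝ E] {f f' : E → F} {s : Set E}
    {x v : E} {w : F} (h : HasDirDeriv f x v w) (hf : EqOn f f' s) (hx : x ∈ interior s) :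
    HasDirDeriv f' x v w := by
  have hc : Continuous fun t : ℝ => x + t • v := by fun_prop
  have h0 : Tendsto (fun t : ℝ => x + t • v) (𝓝 0) (𝓝 x) := by
    simpa using hc.tendsto 0
  refine Tendsto.congr' ?_ h
  filter_upwards [(h0.eventually (mem_interior_iff_mem_nhds.1 hx)).filter_mono
    nhdsWithin_le_nhds] with t ht
  rw [hf ht, hf (interior_subset hx)]

theorem CkOnNat.congr [IsTopologicalAddGroup E] [ContinuousSMul ℝ E] {n : ℕ} {f f' : E → F}
    {s : Set E} (h : CkOnNat n f s) (hf : EqOn f f' s) : CkOnNat n f' s := by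
  cases n with
  | zero => exact ContinuousOn.congr h hf.symm
  | succ n =>
    obtain ⟨hc, g, hg, hgn⟩ := h
    exact ⟨hc.congr hf.symm, g, fun x hx v => (hg x hx v).congr hf hx, hgn⟩

theorem CkOnNat.mono {n : ℕ} : ∀ {E F : Type*} [AddCommGroup E] [Module ℝ E]
    [TopologicalSpace E] [AddCommGroup F] [Module ℝ F] [TopologicalSpace F] {f : E → F}
    {s t : Set E}, CkOnNat n f t → s ⊆ t → CkOnNat n f s := by
  induction n with
  | zero => exact fun h hst => ContinuousOn.mono h hst
  | succ n ih =>
    rintro E F _ _ _ _ _ _ f s t ⟨hf, g, hg, hgn⟩ hst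
    exact ⟨hf.mono hst, g, fun x hx v => hg x (interior_mono hst hx) v,
      ih hgn (prod_mono hst subset_rfl)⟩

theorem CkOnNat.prodMk {n : ℕ} : ∀ {E F G : Type*} [AddCommGroup E] [Module ℝ E]
    [TopologicalSpace E] [AddCommGroup F] [Module ℝ F] [TopologicalSpace F]
    [AddCommGroup G] [Module ℝ G] [TopologicalSpace G] {f : E → F} {f' : E → G} {s : Set E},
    CkOnNat n f s → CkOnNat n f' s → CkOnNat n (fun x => (f x, f' x)) s := by
  induction n with
  | zero => exact fun h h' => ContinuousOn.prodMk h h'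
  | succ n ih =>
    rintro E F G _ _ _ _ _ _ _ _ _ f f' s ⟨hf, g, hg, hgn⟩ ⟨hf', g', hg', hgn'⟩
    exact ⟨hf.prodMk hf', fun p => (g p, g' p), fun x hx v => (hg x hx v).prodMk_nhds (hg' x hx v), ih hgn hgn'⟩

theorem CkOnNat.clm_comp {n : ℕ} : ∀ {E F G : Type*} [AddCommGroup E] [Module ℝ E]
    [TopologicalSpace E] [AddCommGroup F] [Module ℝ F] [TopologicalSpace F]
    [AddCommGroup G] [Module ℝ G] [TopologicalSpace G] {f : E → F} {s : Set E} (L : F →L[ℝ] G),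
    CkOnNat n f s → CkOnNat n (L ∘ f) s := by
  induction n with
  | zero => exact fun L h => L.continuous.comp_continuousOn h
  | succ n ih =>
    rintro E F G _ _ _ _ _ _ _ _ _ f s L ⟨hf, g, hg, hgn⟩
    refine ⟨L.continuous.comp_continuousOn hf, L ∘ g, fun x hx v => ?_, ih L hgn⟩
    refine ((L.continuous.tendsto _).comp (hg x hx v)).congr fun t => ?_
    simp

theorem CkOnNat.snd {n : ℕ} {f : E → F × G} {s : Set E} (h : CkOnNat n f s) :
    CkOnNat n (fun x => (f x).2) s :=
  h.clm_comp (ContinuousLinearMap.snd ℝ F G)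

/-- `extendFrom` is a limit along a filter, and the two filters agree near points of `O`. Hence no
differentiability is needed; even junk values coincide. -/
theorem differential_inter_open (f : E → F) {s O : Set E} (hO : IsOpen O) :
    EqOn (differential f s) (differential f (O ∩ s)) ((O ∩ s) ×ˢ univ) := by
  rintro ⟨x, v⟩ ⟨hx, -⟩
  unfold differential extendFrom
  congr 1
  rw [nhdsWithin_prod_eq, nhdsWithin_prod_eq, interior_inter, hO.interior_eq,
    inter_comm, nhdsWithin_inter_of_mem' (nhdsWithin_le_nhds (hO.mem_nhds hx.1))]

variable [IsTopologicalAddGroup E] [ContinuousSMul ℝ E]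

theorem ckOnNat_const {n : ℕ} : ∀ {E F : Type*} [AddCommGroup E] [Module ℝ E]
    [TopologicalSpace E] [AddCommGroup F] [Module ℝ F] [TopologicalSpace F] (c : F) (s : Set E),
    CkOnNat n (fun _ => c) s := by
  induction n with
  | zero => exact fun c s => continuousOn_const
  | succ n ih =>
    intro E F _ _ _ _ _ _ c s
    exact ⟨continuousOn_const, fun _ => 0, fun x _ v => by simp [HasDirDeriv, tendsto_const_nhds],
      ih _ _⟩

theorem ckOnNat_clm {n : ℕ} : ∀ {E F : Type*} [AddCommGroup E] [Module ℝ E]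
    [TopologicalSpace E] [IsTopologicalAddGroup E] [ContinuousSMul ℝ E] [AddCommGroup F]
    [Module ℝ F] [TopologicalSpace F] (L : E →L[ℝ] F) (s : Set E), CkOnNat n L s := by
  induction n with
  | zero => exact fun L s => L.continuous.continuousOn
  | succ n ih =>
    intro E F _ _ _ _ _ _ _ _ L s
    exact ⟨L.continuous.continuousOn, L.comp (ContinuousLinearMap.snd ℝ E E),
      fun x hx v => ((isC1_clm L s).3 x (interior_subset hx) v).hasDirDeriv hx, ih _ _⟩

theorem IsC1.ckOnNat_succ {n : ℕ} {f : E → F} {g : E × E → F} {s : Set E}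
    (h : IsC1 f g s) (hn : CkOnNat n g (s ×ˢ univ)) : CkOnNat (n + 1) f s :=
  ⟨h.1, _, fun x hx v => (h.3 x (interior_subset hx) v).hasDirDeriv hx, hn⟩

variable [IsTopologicalAddGroup F] [ContinuousSMul ℝ F]
  [LocallyConvexSpace ℝ E] [LocallyConvexSpace ℝ F] [T2Space F]

theorem CkOnNat.isC1 {n : ℕ} {f : E → F} {s : Set E} (hs : Adm s) (h : CkOnNat (n + 1) f s) :
    IsC1 f (differential f s) s := by
  obtain ⟨hf, g, hg, hgn⟩ := h
  exact (isC1_of_hasDirDeriv hs hf hgn.continuousOn hg).isC1_differential hs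

/-- Replaces the existential `g` of the definition by the canonical `differential f s`, with which
it must agree on `s × E`. -/
theorem ckOnNat_succ_iff {n : ℕ} {f : E → F} {s : Set E} (hs : Adm s) :
    CkOnNat (n + 1) f s ↔
      IsC1 f (differential f s) s ∧ CkOnNat n (differential f s) (s ×ˢ univ) := by
  constructor
  · rintro ⟨hf, g, hg, hgn⟩
    have h := isC1_of_hasDirDeriv hs hf hgn.continuousOn hg
    exact ⟨h.isC1_differential hs, hgn.congr (h.differential_eq hs).symm⟩
  · rintro ⟨h, hn⟩
    exact ⟨h.1, _, fun x hx v => (h.3 x (interior_subset hx) v).hasDirDeriv hx, hn⟩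

/-- The local derivatives have to be glued to a single map on `s × E`; `differential f s` does this
because it depends only on germs. -/
theorem CkOnNat.of_local {n : ℕ} : ∀ {E F : Type*} [AddCommGroup E] [Module ℝ E]
    [TopologicalSpace E] [IsTopologicalAddGroup E] [ContinuousSMul ℝ E] [LocallyConvexSpace ℝ E]
    [AddCommGroup F] [Module ℝ F] [TopologicalSpace F] [IsTopologicalAddGroup F]
    [ContinuousSMul ℝ F] [LocallyConvexSpace ℝ F] [T2Space F] {f : E → F} {s : Set E},
    Adm s → (∀ x ∈ s, ∃ O, IsOpen O ∧ x ∈ O ∧ CkOnNat n f (O ∩ s)) → CkOnNat n f s := by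
  have hcont : ∀ {n : ℕ} {E F : Type _} [AddCommGroup E] [Module ℝ E]
    [TopologicalSpace E] [AddCommGroup F] [Module ℝ F] [TopologicalSpace F] {f : E → F}
    {s : Set E}, (∀ x ∈ s, ∃ O, IsOpen O ∧ x ∈ O ∧ CkOnNat n f (O ∩ s)) → ContinuousOn f s := by
    intro n E F _ _ _ _ _ _ f s h x hx
    obtain ⟨O, hO, hxO, hn⟩ := h x hx
    refine (hn.continuousOn x ⟨hxO, hx⟩).mono_of_mem_nhdsWithin ?_
    exact inter_mem (nhdsWithin_le_nhds (hO.mem_nhds hxO)) self_mem_nhdsWithin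
  induction n with
  | zero => exact fun _ h => hcont h
  | succ n ih =>
    intro E F _ _ _ _ _ _ _ _ _ _ _ _ _ f s hs h
    refine ⟨hcont h, differential f s, fun x hx v => ?_, ih hs.prod_univ ?_⟩
    · obtain ⟨O, hO, hxO, hn⟩ := h x (interior_subset hx)
      rw [differential_inter_open f hO ⟨⟨hxO, interior_subset hx⟩, trivial⟩]
      refine ((hn.isC1 (hs.inter_open hO)).3 x ⟨hxO, interior_subset hx⟩ v).hasDirDeriv ?_
      rw [interior_inter, hO.interior_eq]
      exact ⟨hxO, hx⟩
    · rintro ⟨x, v⟩ ⟨hx, -⟩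
      obtain ⟨O, hO, hxO, hn⟩ := h x hx
      refine ⟨O ×ˢ univ, hO.prod isOpen_univ, ⟨hxO, trivial⟩, ?_⟩
      rw [prod_inter_prod, univ_inter]
      exact ((ckOnNat_succ_iff (hs.inter_open hO)).1 hn).2.congr
        (differential_inter_open f hO).symm

/-- The tangent map of `L` is the linear map `L × L`, so the induction stays within linear inner
maps, and `s'` may be arbitrary. The case `L = fst` enters the general chain rule. -/
theorem CkOnNat.comp_clm {n : ℕ} : ∀ {E E' F : Type*} [AddCommGroup E] [Module ℝ E]
    [TopologicalSpace E] [IsTopologicalAddGroup E] [ContinuousSMul ℝ E] [LocallyConvexSpace ℝ E]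
    [AddCommGroup E'] [Module ℝ E'] [TopologicalSpace E'] [IsTopologicalAddGroup E']
    [ContinuousSMul ℝ E']
    [AddCommGroup F] [Module ℝ F] [TopologicalSpace F] [IsTopologicalAddGroup F]
    [ContinuousSMul ℝ F] [LocallyConvexSpace ℝ F] [T2Space F]
    {f : E → F} {s : Set E} {L : E' →L[ℝ] E} {s' : Set E'}, Adm s →
    CkOnNat n f s → MapsTo L s' s → CkOnNat n (f ∘ L) s' := by
  induction n with
  | zero => exact fun {E E' F _ _ _ _ _ _ _ _ _ _ _ _ _ _ _ _ _ _ f s L s'} _ hf hm =>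
      ContinuousOn.comp hf L.continuous.continuousOn hm
  | succ n ih =>
    intro E E' F _ _ _ _ _ _ _ _ _ _ _ _ _ _ _ _ _ _ f s L s' hs hf hm
    obtain ⟨hf1, hf2⟩ := (ckOnNat_succ_iff hs).1 hf
    exact (hf1.comp (isC1_clm L s') hm).ckOnNat_succ
      (ih (L := L.prodMap L) hs.prod_univ hf2 fun p hp => ⟨hm hp.1, trivial⟩)

/-- The differential of `h ∘ f` is `dh ∘ (f ∘ fst, df)`, again a composition, now of `C^n`-maps
between larger spaces. The spaces are therefore quantified inside the induction. -/
theorem CkOnNat.comp {n : ℕ} : ∀ {E F G : Type*} [AddCommGroup E] [Module ℝ E]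
    [TopologicalSpace E] [IsTopologicalAddGroup E] [ContinuousSMul ℝ E] [LocallyConvexSpace ℝ E]
    [AddCommGroup F] [Module ℝ F] [TopologicalSpace F] [IsTopologicalAddGroup F]
    [ContinuousSMul ℝ F] [LocallyConvexSpace ℝ F] [T2Space F]
    [AddCommGroup G] [Module ℝ G] [TopologicalSpace G] [IsTopologicalAddGroup G]
    [ContinuousSMul ℝ G] [LocallyConvexSpace ℝ G] [T2Space G]
    {f : E → F} {s : Set E} {h : F → G} {r : Set F}, Adm s → Adm r →
    CkOnNat n h r → CkOnNat n f s → MapsTo f s r → CkOnNat n (h ∘ f) s := by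
  induction n with
  | zero => exact fun _ _ hh hf hm => ContinuousOn.comp hh hf hm
  | succ n ih =>
    intro E F G _ _ _ _ _ _ _ _ _ _ _ _ _ _ _ _ _ _ _ _ f s h r hs hr hh hf hm
    obtain ⟨hh1, hh2⟩ := (ckOnNat_succ_iff hr).1 hh
    obtain ⟨hf1, hf2⟩ := (ckOnNat_succ_iff hs).1 hf
    refine (hh1.comp hf1 hm).ckOnNat_succ ?_
    refine ih (f := fun p : E × E => (f p.1, differential f s p)) (h := differential h r)
      hs.prod_univ hr.prod_univ hh2 (CkOnNat.prodMk ?_ hf2) (fun p hp => ⟨hm hp.1, trivial⟩)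
    exact CkOnNat.comp_clm (L := ContinuousLinearMap.fst ℝ E E) hs hf.of_succ fun p hp => hp.1

end CkOnNat

/-! ### Manifolds with charts that are embeddings onto admissible sets -/

namespace Mfd

/-- The charts of `M` are homeomorphisms from open sets onto admissible subsets of a locally convex
Hausdorff space, and they cover `M`. -/
class TopMfd (M : Mfd.{u}) : Prop where
  isTopologicalAddGroup : IsTopologicalAddGroup M.E
  continuousSMul : ContinuousSMul ℝ M.E
  locallyConvexSpace : LocallyConvexSpace ℝ M.E
  t2Space : T2Space M.E
  mem_source : ∀ x, x ∈ M.source (M.chartAt x)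
  isOpen_source : ∀ i, IsOpen (M.source i)
  isEmbedding : ∀ i, IsEmbedding (fun x : M.source i => M.coord i x)
  adm : ∀ i, Adm (M.coord i '' M.source i)

attribute [instance] TopMfd.isTopologicalAddGroup TopMfd.continuousSMul
  TopMfd.locallyConvexSpace TopMfd.t2Space

/-- All changes of charts are `C^n`. -/
def CnAtlas (n : ℕ) (M : Mfd.{u}) : Prop :=
  ∀ i j, CkOnNat n (rep (M := M) (N := M) id i j) (repSet (M := M) (N := M) id i j)

/-- `f` is `C^n`, for finite `n`. -/
def IsCn {M : Mfd.{u}} {N : Mfd.{w}} (n : ℕ) (f : M.carrier → N.carrier) : Prop :=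
  Continuous f ∧ ∀ i j, CkOnNat n (rep f i j) (repSet f i j)

variable {M : Mfd.{u}} {N : Mfd.{w}} {P : Mfd.{v}} 

theorem isCk_iff {k : ℕ∞} {f : M.carrier → N.carrier} :
    IsCk k f ↔ ∀ n : ℕ, (n : ℕ∞) ≤ k → IsCn n f :=
  ⟨fun h n hn => ⟨h.1, fun i j => h.2 i j n hn⟩,
    fun h => ⟨(h 0 (by simp)).1, fun i j n hn => (h n hn).2 i j⟩⟩

theorem IsCn.of_le {n m : ℕ} {f : M.carrier → N.carrier} (h : IsCn n f) (hmn : m ≤ n) : IsCn m f :=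
  ⟨h.1, fun i j => (h.2 i j).of_le hmn⟩

theorem CnAtlas.of_le {n m : ℕ} (h : CnAtlas n M) (hmn : m ≤ n) : CnAtlas m M :=
  fun i j => (h i j).of_le hmn

theorem CnAtlas.isCn_id {n : ℕ} (h : CnAtlas n M) : IsCn (M := M) (N := M) n id :=
  ⟨continuous_id, h⟩

theorem repDom_subset (f : M.carrier → N.carrier) (i : M.ι) (j : N.ι) :
    repDom f i j ⊆ M.source i :=
  inter_subset_left

theorem coord_mem_repSet {f : M.carrier → N.carrier} {i : M.ι} {j : N.ι} {x : M.carrier}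
    (hx : x ∈ repDom f i j) : M.coord i x ∈ repSet f i j :=
  mem_image_of_mem _ hx

variable [TopMfd M] [TopMfd N] [TopMfd P]

theorem injOn_coord (i : M.ι) : InjOn (M.coord i) (M.source i) :=
  injOn_iff_injective.2 (TopMfd.isEmbedding i).injective

theorem map_coord_nhdsWithin {i : M.ι} {W : Set M.carrier} (hW : W ⊆ M.source i) {x : M.carrier}
    (hx : x ∈ W) : map (M.coord i) (𝓝[W] x) = 𝓝[M.coord i '' W] (M.coord i x) := by
  have h : IsEmbedding (fun y : W => M.coord i y) :=
    (TopMfd.isEmbedding i).comp (IsEmbedding.inclusion hW)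
  rw [nhdsWithin_eq_map_subtype_coe hx, map_map]
  have := h.map_nhds_eq ⟨x, hx⟩
  rw [image_eq_range]
  exact this

theorem continuousOn_image_coord_iff {Z : Type*} [TopologicalSpace Z] {i : M.ι} {W : Set M.carrier}
    (hW : W ⊆ M.source i) {h : M.E → Z} :
    ContinuousOn h (M.coord i '' W) ↔ ContinuousOn (fun x => h (M.coord i x)) W := by
  simp only [ContinuousOn, forall_mem_image, ContinuousWithinAt]
  refine forall₂_congr fun x hx => ?_
  rw [← map_coord_nhdsWithin hW hx, tendsto_map'_iff]
  rfl

theorem continuousOn_coord (i : M.ι) : ContinuousOn (M.coord i) (M.source i) :=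
  (continuousOn_image_coord_iff subset_rfl (h := id)).1 continuousOn_id

/-- A chart is injective on its whole domain, so the same `O` cuts out the image of `W` from that of
every intermediate `W'`. -/
theorem exists_image_coord_eq {i : M.ι} {W : Set M.carrier} (hW : IsOpen W)
    (hWi : W ⊆ M.source i) : ∃ O : Set M.E, IsOpen O ∧
      ∀ W', W ⊆ W' → W' ⊆ M.source i → M.coord i '' W = O ∩ M.coord i '' W' := by
  obtain ⟨O, hO, h⟩ := (TopMfd.isEmbedding i).isInducing.isOpen_iff.1
    (hW.preimage (continuous_subtype_val (p := (· ∈ M.source i))))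
  have h' : ∀ x ∈ M.source i, M.coord i x ∈ O ↔ x ∈ W := fun x hx =>
    Set.ext_iff.1 h ⟨x, hx⟩
  refine ⟨O, hO, fun W' h1 h2 => ?_⟩
  ext y
  constructor
  · rintro ⟨x, hx, rfl⟩
    exact ⟨(h' x (hWi hx)).2 hx, mem_image_of_mem _ (h1 hx)⟩
  · rintro ⟨hy, x, hx, rfl⟩
    exact mem_image_of_mem _ ((h' x (h2 hx)).1 hy)

theorem adm_image_coord {i : M.ι} {W : Set M.carrier} (hW : IsOpen W)
    (hWi : W ⊆ M.source i) : Adm (M.coord i '' W) := by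
  obtain ⟨O, hO, h⟩ := exists_image_coord_eq hW hWi
  rw [h _ hWi subset_rfl]
  exact (TopMfd.adm i).inter_open hO

theorem isOpen_repDom {f : M.carrier → N.carrier} (hf : Continuous f) (i : M.ι) (j : N.ι) :
    IsOpen (repDom f i j) :=
  (TopMfd.isOpen_source i).inter ((TopMfd.isOpen_source j).preimage hf)

theorem adm_repSet {f : M.carrier → N.carrier} (hf : Continuous f) (i : M.ι) (j : N.ι) :
    Adm (repSet f i j) :=
  adm_image_coord (isOpen_repDom hf i j) (repDom_subset f i j)

theorem rep_coord {N : Mfd.{w}} {f : M.carrier → N.carrier} {i : M.ι} {j : N.ι} {x : M.carrier}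
    (hx : x ∈ repDom f i j) : rep f i j (M.coord i x) = N.coord j (f x) := by
  have h : Function.Injective (fun x : repDom f i j => M.coord i x.1) := fun y z hyz =>
    Subtype.ext (injOn_coord i (repDom_subset f i j y.2) (repDom_subset f i j z.2) hyz)
  exact h.extend_apply _ _ (⟨x, hx⟩ : repDom f i j)

theorem tendsto_nhds_of_coord {Z : Type*} {l : Filter Z} {f : Z → M.carrier} {x : M.carrier}
    {i : M.ι} (hx : x ∈ M.source i) (hf : ∀ᶠ z in l, f z ∈ M.source i)
    (h : Tendsto (fun z => M.coord i (f z)) l (𝓝 (M.coord i x))) : Tendsto f l (𝓝 x) := by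
  have h3 : Tendsto (fun z => M.coord i (f z)) l (𝓝[M.coord i '' M.source i] (M.coord i x)) :=
    tendsto_nhdsWithin_iff.2 ⟨h, hf.mono fun z hz => mem_image_of_mem _ hz⟩
  rw [← map_coord_nhdsWithin subset_rfl hx] at h3
  intro U hU
  have h4 : M.coord i '' (U ∩ M.source i) ∈ map (M.coord i) (𝓝[M.source i] x) :=
    image_mem_map (inter_mem (nhdsWithin_le_nhds hU) self_mem_nhdsWithin)
  have h5 : ∀ᶠ z in l, M.coord i (f z) ∈ M.coord i '' (U ∩ M.source i) := h3 h4
  rw [mem_map]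
  filter_upwards [h5, hf] with z ⟨y, hy, hyz⟩ hz
  rw [mem_preimage, ← injOn_coord i hy.2 hz hyz]
  exact hy.1

theorem continuousAt_coord {i : M.ι} {x : M.carrier} (hx : x ∈ M.source i) :
    ContinuousAt (M.coord i) x :=
  (continuousOn_coord i).continuousAt ((TopMfd.isOpen_source i).mem_nhds hx)

/-- Openness of the domains of the representatives has to be assumed: it would normally follow from
the continuity that is being proved. -/
theorem continuous_of_continuousOn_rep {f : M.carrier → N.carrier}
    (ho : ∀ i j, IsOpen (repDom f i j))
    (h : ∀ x, ∃ i j, x ∈ repDom f i j ∧ ContinuousOn (rep f i j) (repSet f i j)) :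
    Continuous f := by
  refine continuous_iff_continuousAt.2 fun x => ?_
  obtain ⟨i, j, hx, hc⟩ := h x
  have h1 : ContinuousOn (fun y => N.coord j (f y)) (repDom f i j) :=
    ((continuousOn_image_coord_iff (repDom_subset f i j)).1 hc).congr fun y hy => (rep_coord hy).symm
  have h2 := (ho i j).mem_nhds hx
  exact tendsto_nhds_of_coord hx.2 (by filter_upwards [h2] with y hy using hy.2)
    (h1.continuousAt h2)

/-- `f` is `C^n` in a neighbourhood of `x`, with respect to the charts with indices `i` and `j`. -/
def CnNear (n : ℕ) (f : M.carrier → N.carrier) (i : M.ι) (j : N.ι) (x : M.carrier) : Prop :=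
  ∃ W, IsOpen W ∧ x ∈ W ∧ W ⊆ repDom f i j ∧ CkOnNat n (rep f i j) (M.coord i '' W)

theorem ckOnNat_rep_iff {n : ℕ} {f : M.carrier → N.carrier} (hf : Continuous f) {i : M.ι}
    {j : N.ι} : CkOnNat n (rep f i j) (repSet f i j) ↔ ∀ x ∈ repDom f i j, CnNear n f i j x := by
  refine ⟨fun h x hx => ⟨_, isOpen_repDom hf i j, hx, subset_rfl, h⟩,
    fun h => CkOnNat.of_local (adm_repSet hf i j) ?_⟩
  rintro _ ⟨x, hx, rfl⟩
  obtain ⟨W, hW, hxW, hWs, hn⟩ := h x hx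
  obtain ⟨O, hO, hOe⟩ := exists_image_coord_eq hW (hWs.trans (repDom_subset f i j))
  refine ⟨O, hO, ?_, ?_⟩
  · exact (hOe _ hWs (repDom_subset f i j) ▸ mem_image_of_mem _ hxW :
      M.coord i x ∈ O ∩ M.coord i '' repDom f i j).1
  · unfold repSet
    rwa [← hOe _ hWs (repDom_subset f i j)]

theorem eqOn_rep_comp {P : Mfd.{v}} {f : M.carrier → N.carrier} {g : N.carrier → P.carrier} {i : M.ι} {j : N.ι}
    {l : P.ι} {W : Set M.carrier} (hWf : W ⊆ repDom f i j) (hWg : MapsTo f W (repDom g j l)) :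
    MapsTo (rep f i j) (M.coord i '' W) (repSet g j l) ∧
      EqOn (rep g j l ∘ rep f i j) (rep (g ∘ f) i l) (M.coord i '' W) := by
  constructor
  · rintro _ ⟨x, hx, rfl⟩
    rw [rep_coord (hWf hx)]
    exact mem_image_of_mem _ (hWg hx)
  · rintro _ ⟨x, hx, rfl⟩
    rw [Function.comp_apply, rep_coord (hWf hx), rep_coord (hWg hx),
      rep_coord (f := g ∘ f) ⟨(hWf hx).1, (hWg hx).2⟩]
    rfl

theorem CnNear.comp {n : ℕ} {f : M.carrier → N.carrier} {g : N.carrier → P.carrier}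
    {i : M.ι} {j : N.ι} {l : P.ι} {x : M.carrier} (hg : CnNear n g j l (f x))
    (hf : CnNear n f i j x) (hfc : Continuous f) : CnNear n (g ∘ f) i l x := by
  obtain ⟨W, hW, hxW, hWf, hfn⟩ := hf
  obtain ⟨V, hV, hxV, hVg, hgn⟩ := hg
  have h1 : W ∩ f ⁻¹' V ⊆ repDom f i j := inter_subset_left.trans hWf
  have h2 : MapsTo f (W ∩ f ⁻¹' V) (repDom g j l) := fun y hy => hVg hy.2
  have h3 : IsOpen (W ∩ f ⁻¹' V) := hW.inter (hV.preimage hfc)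
  refine ⟨_, h3, ⟨hxW, hxV⟩, fun y hy => ⟨(h1 hy).1, (h2 hy).2⟩, ?_⟩
  refine (CkOnNat.comp (adm_image_coord h3 (h1.trans (repDom_subset f i j)))
    (adm_image_coord hV (hVg.trans (repDom_subset g j l))) hgn
    (hfn.mono (image_mono inter_subset_left)) ?_).congr (eqOn_rep_comp h1 h2).2
  rintro _ ⟨y, hy, rfl⟩
  rw [rep_coord (h1 hy)]
  exact mem_image_of_mem _ hy.2

theorem IsCn.cnNear {n : ℕ} {f : M.carrier → N.carrier} (hf : IsCn n f) {i : M.ι} {j : N.ι}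
    {x : M.carrier} (hx : x ∈ M.source i) (hfx : f x ∈ N.source j) : CnNear n f i j x :=
  (ckOnNat_rep_iff hf.1).1 (hf.2 i j) x ⟨hx, hfx⟩

theorem IsCn.comp {n : ℕ} {f : M.carrier → N.carrier} {g : N.carrier → P.carrier}
    (hg : IsCn n g) (hf : IsCn n f) : IsCn n (g ∘ f) := by
  refine ⟨hg.1.comp hf.1, fun i l => (ckOnNat_rep_iff (hg.1.comp hf.1)).2 fun x hx => ?_⟩
  exact (hg.cnNear (TopMfd.mem_source (f x)) hx.2).comp (hf.cnNear hx.1 (TopMfd.mem_source _)) hf.1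

/-- One pair of charts around each point suffices: in any other pair, `f` is locally `id ∘ f ∘ id`,
and the outer factors are changes of charts. -/
theorem isCn_of_charts {n : ℕ} (hM : CnAtlas n M) (hN : CnAtlas n N) {f : M.carrier → N.carrier}
    (ho : ∀ i j, IsOpen (repDom f i j))
    (h : ∀ x, ∃ i j, x ∈ repDom f i j ∧ CkOnNat n (rep f i j) (repSet f i j)) : IsCn n f := by
  have hf : Continuous f := continuous_of_continuousOn_rep ho fun x =>
    let ⟨i, j, hx, hn⟩ := h x
    ⟨i, j, hx, hn.continuousOn⟩
  refine ⟨hf, fun i' j' => (ckOnNat_rep_iff hf).2 fun x hx => ?_⟩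
  obtain ⟨i, j, hx', hn⟩ := h x
  have h1 : CnNear n f i j x := (ckOnNat_rep_iff hf).1 hn x hx'
  have h2 : CnNear (M := M) (N := M) n id i' i x := hM.isCn_id.cnNear hx.1 hx'.1
  have h3 : CnNear (M := N) (N := N) n id j j' (f x) := hN.isCn_id.cnNear hx'.2 hx.2
  exact h3.comp (f := f) (h1.comp (f := id) h2 continuous_id) hf

theorem IsCn.isC1 {n : ℕ} {f : M.carrier → N.carrier} (hf : IsCn (n + 1) f) (i : M.ι) (j : N.ι) :
    IsC1 (rep f i j) (differential (rep f i j) (repSet f i j)) (repSet f i j) :=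
  (hf.2 i j).isC1 (adm_repSet hf.1 i j)

theorem dRep_eq {f : M.carrier → N.carrier} (hf : Continuous f) {i : M.ι} {j : N.ι}
    {g : M.E × M.E → N.E} (h : IsC1 (rep f i j) g (repSet f i j)) {x : M.carrier}
    (hx : x ∈ repDom f i j) (v : M.E) : dRep f i j x v = g (M.coord i x, v) :=
  h.differential_eq (adm_repSet hf i j) (x := (M.coord i x, v)) ⟨coord_mem_repSet hx, trivial⟩

/-- The representatives compose only over `W`, which can be smaller than the domain of the
representative of `g ∘ f`. Uniqueness of the differential on the admissible image of `W` compares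
the two. -/
theorem dRep_comp {f : M.carrier → N.carrier} {g : N.carrier → P.carrier} (hg : IsCn 1 g)
    (hf : IsCn 1 f) {i : M.ι} {j : N.ι} {l : P.ι} {x : M.carrier} (hx : x ∈ M.source i)
    (hfx : f x ∈ N.source j) (hgx : g (f x) ∈ P.source l) (v : M.E) :
    dRep (g ∘ f) i l x v = dRep g j l (f x) (dRep f i j x v) := by
  set W := repDom f i j ∩ f ⁻¹' repDom g j l with hW
  have hWo : IsOpen W := (isOpen_repDom hf.1 i j).inter ((isOpen_repDom hg.1 j l).preimage hf.1)
  have hWf : W ⊆ repDom f i j := inter_subset_left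
  have hWg : MapsTo f W (repDom g j l) := fun y hy => hy.2
  have hWs : W ⊆ repDom (g ∘ f) i l := fun y hy => ⟨hy.1.1, hy.2.2⟩
  have hxW : x ∈ W := ⟨⟨hx, hfx⟩, hfx, hgx⟩
  obtain ⟨hm, he⟩ := eqOn_rep_comp hWf hWg
  have h1 := (((hg.isC1 j l).comp ((hf.isC1 i j).mono (image_mono hWf)) hm).congr he).eqOn
    (adm_image_coord hWo (hWf.trans (repDom_subset f i j)))
    (((hg.comp hf).isC1 i l).mono (image_mono hWs))
  have h2 := h1 (x := (M.coord i x, v)) ⟨mem_image_of_mem _ hxW, trivial⟩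
  simp only [rep_coord (hWf hxW)] at h2
  exact h2.symm

theorem dRep_id {i : M.ι} {x : M.carrier} (hx : x ∈ M.source i) (v : M.E) :
    dRep (M := M) (N := M) id i i x v = v := by
  have h : IsC1 (rep (M := M) (N := M) id i i) (fun p => p.2)
      (repSet (M := M) (N := M) id i i) := by
    refine (isC1_clm (ContinuousLinearMap.id ℝ M.E) _).congr ?_
    rintro _ ⟨y, hy, rfl⟩
    rw [rep_coord hy]
    rfl
  exact dRep_eq continuous_id h ⟨hx, hx⟩ v

/-! ### The tangent bundle as a manifold and the tangent functor -/

section Tangent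

variable {M : Mfd.{u}} {N : Mfd.{w}} {P : Mfd.{v}}

theorem isOpen_T_iff {O : Set (T M).carrier} : IsOpen O ↔ ∀ i, ∃ V : Set (M.E × M.E), IsOpen V ∧
    ∀ p : (T M).carrier, p.1 ∈ M.source i → (tCoord M i p ∈ V ↔ p ∈ O) := by
  refine isOpen_iSup_iff.trans (forall_congr' fun i => ?_)
  refine isOpen_coinduced.trans (isOpen_induced_iff.trans ?_)
  refine exists_congr fun V => and_congr_right fun _ => ?_
  rw [Set.ext_iff]
  exact ⟨fun h p hp => h ⟨p, hp⟩, fun h p => h p.1 p.2⟩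

variable [TopMfd M] [TopMfd N] [TopMfd P]

theorem tMap_comp {f : M.carrier → N.carrier} {g : N.carrier → P.carrier} (hg : IsCn 1 g)
    (hf : IsCn 1 f) : tMap (g ∘ f) = tMap g ∘ tMap f := by
  funext p
  exact Prod.ext rfl (dRep_comp hg hf (TopMfd.mem_source _) (TopMfd.mem_source _)
    (TopMfd.mem_source _) _)

theorem tMap_id : tMap (M := M) (N := M) id = id := by
  funext p
  exact Prod.ext rfl (dRep_id (TopMfd.mem_source _) _)

/-- Both vector parts are the differential of `f` from the preferred chart at `p.1` to the chart
`j`: once factored through the preferred chart at `f p.1`, once through the chart `i`. -/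
theorem tCoord_tMap (hM : CnAtlas 1 M) (hN : CnAtlas 1 N) {f : M.carrier → N.carrier}
    (hf : IsCn 1 f) {i : M.ι} {j : N.ι} {p : (T M).carrier} (hp : p.1 ∈ repDom f i j) :
    tCoord N j (tMap f p) = (rep f i j (tCoord M i p).1,
      differential (rep f i j) (repSet f i j) (tCoord M i p)) := by
  refine Prod.ext (rep_coord hp).symm ?_
  have h1 := dRep_comp (i := M.chartAt p.1) hN.isCn_id hf (TopMfd.mem_source _)
    (TopMfd.mem_source (f p.1)) hp.2 p.2
  have h2 := dRep_comp (i := M.chartAt p.1) hf hM.isCn_id (TopMfd.mem_source _)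
    (show id p.1 ∈ M.source i from hp.1) hp.2 p.2
  exact h1.symm.trans h2

theorem tCoord_change (hM : CnAtlas 1 M) {i j : M.ι} {p : (T M).carrier} (hi : p.1 ∈ M.source i)
    (hj : p.1 ∈ M.source j) :
    tCoord M j p = (rep (M := M) (N := M) id i j (tCoord M i p).1,
      differential (rep (M := M) (N := M) id i j) (repSet (M := M) (N := M) id i j)
        (tCoord M i p)) := by
  have h := tCoord_tMap hM hM hM.isCn_id (i := i) (j := j) (p := p) ⟨hi, hj⟩
  rwa [tMap_id] at h

theorem IsCn.continuousOn_tRep {f : M.carrier → N.carrier} (hf : IsCn 1 f) (i : M.ι) (j : N.ι) :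
    ContinuousOn (fun p : M.E × M.E => (rep f i j p.1, differential (rep f i j) (repSet f i j) p))
      (repSet f i j ×ˢ univ) :=
  ((hf.isC1 i j).1.comp continuousOn_fst fun _ hp => hp.1).prodMk (hf.isC1 i j).2

/-- On each fibre, the change of charts in the opposite direction is a right inverse. -/
theorem exists_tCoord_eq (hM : CnAtlas 1 M) {i : M.ι} {x : M.carrier} (hx : x ∈ M.source i)
    (w : M.E) : ∃ v, tCoord M i (x, v) = (M.coord i x, w) := by
  refine ⟨dRep (M := M) (N := M) id i (M.chartAt x) x w, Prod.ext rfl ?_⟩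
  have h := dRep_comp (f := id) (g := id) (l := i) hM.isCn_id hM.isCn_id hx
    (show id x ∈ M.source (M.chartAt x) from TopMfd.mem_source x) hx w
  exact h.symm.trans (dRep_id hx w)

theorem image_tCoord (hM : CnAtlas 1 M) {i : M.ι} {W : Set M.carrier} (hW : W ⊆ M.source i) :
    tCoord M i '' {p | p.1 ∈ W} = (M.coord i '' W) ×ˢ univ := by
  ext ⟨y, w⟩
  constructor
  · rintro ⟨p, hp, h⟩
    rw [← h]
    exact ⟨mem_image_of_mem _ hp, trivial⟩
  · rintro ⟨⟨x, hx, rfl⟩, -⟩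
    obtain ⟨v, hv⟩ := exists_tCoord_eq hM (hW hx) w
    exact ⟨(x, v), hx, hv⟩

theorem injOn_tCoord (hM : CnAtlas 1 M) (i : M.ι) :
    InjOn (tCoord M i) {p | p.1 ∈ M.source i} := by
  rintro ⟨x, v⟩ hx ⟨y, w⟩ hy h
  obtain rfl : x = y := injOn_coord i hx hy (congrArg Prod.fst h)
  have h1 := tCoord_change hM (p := ((x, v) : (T M).carrier)) hx (TopMfd.mem_source x)
  have h2 := tCoord_change hM (p := ((x, w) : (T M).carrier)) hx (TopMfd.mem_source x)
  rw [h, ← h2] at h1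
  have h3 := congrArg Prod.snd h1
  simp only [tCoord] at h3
  rw [dRep_id (TopMfd.mem_source x), dRep_id (TopMfd.mem_source x)] at h3
  rw [h3]

theorem isOpen_T_preimage_fst {W : Set M.carrier} (hW : IsOpen W) :
    IsOpen ({p | p.1 ∈ W} : Set (T M).carrier) := by
  refine isOpen_T_iff.2 fun i => ?_
  obtain ⟨O, hO, hOe⟩ := exists_image_coord_eq (hW.inter (TopMfd.isOpen_source i)) inter_subset_right
  have h := hOe _ inter_subset_right subset_rfl
  refine ⟨O ×ˢ univ, hO.prod isOpen_univ, fun p hp => ⟨fun hpO => ?_, fun hpW => ?_⟩⟩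
  · have : M.coord i p.1 ∈ M.coord i '' (W ∩ M.source i) := by
      rw [h]
      exact ⟨hpO.1, mem_image_of_mem _ hp⟩
    obtain ⟨y, hy, hyp⟩ := this
    exact (injOn_coord i hy.2 hp hyp ▸ hy.1 : p.1 ∈ W)
  · have : M.coord i p.1 ∈ O ∩ M.coord i '' M.source i := by
      rw [← h]
      exact mem_image_of_mem _ ⟨hpW, hp⟩
    exact ⟨this.1, trivial⟩

theorem continuous_T_fst : Continuous (fun p : (T M).carrier => (p.1 : M.carrier)) :=
  ⟨fun _ hW => isOpen_T_preimage_fst hW⟩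

/-- That open sets are seen by `tCoord M i` is built into the topology of `TM`. Conversely, the part
of `TU_i` cut out by `V` must be open in every other chart `j`, which is continuity of the change of
tangent charts. -/
theorem isEmbedding_tCoord (hM : CnAtlas 1 M) (i : M.ι) :
    IsEmbedding (fun p : {p : (T M).carrier | p.1 ∈ M.source i} => tCoord M i p.1) := by
  refine ⟨⟨TopologicalSpace.ext_iff.2 fun A => ⟨fun hA => ?_, fun hA => ?_⟩⟩,
    injOn_iff_injective.1 (injOn_tCoord hM i)⟩
  · obtain ⟨O, hO, rfl⟩ := isOpen_induced_iff.1 hA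
    obtain ⟨V, hV, h⟩ := isOpen_T_iff.1 hO i
    exact isOpen_induced_iff.2 ⟨V, hV, Set.ext fun p => h p.1 p.2⟩
  · obtain ⟨V, hV, rfl⟩ := isOpen_induced_iff.1 hA
    refine isOpen_induced_iff.2 ⟨{p : (T M).carrier | p.1 ∈ M.source i ∧ tCoord M i p ∈ V},
      isOpen_T_iff.2 fun j => ?_, Set.ext fun p => ⟨fun h => h.2, fun h => ⟨p.2, h⟩⟩⟩
    -- `V'` pulls `V` back to the chart `j`, but only over the overlap of the two charts; the factor
    -- `O` below cuts out this overlap.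
    obtain ⟨V', hV', hVV⟩ := continuousOn_iff'.1 (hM.isCn_id.continuousOn_tRep j i) V hV
    have hrep := isOpen_repDom (M := M) (N := M) continuous_id j i
    obtain ⟨O, hO, hOe⟩ := exists_image_coord_eq hrep (repDom_subset _ j i)
    have hOe := hOe _ (repDom_subset _ j i) subset_rfl
    refine ⟨V' ∩ O ×ˢ univ, hV'.inter (hO.prod isOpen_univ), fun p hp => ?_⟩
    have key : tCoord M j p ∈ O ×ˢ (univ : Set M.E) ↔ p.1 ∈ M.source i := by
      refine ⟨fun h => ?_, fun h => ?_⟩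
      · have : M.coord j p.1 ∈ M.coord j '' repDom (M := M) (N := M) id j i := by
          rw [hOe]
          exact ⟨h.1, mem_image_of_mem _ hp⟩
        obtain ⟨y, hy, hyp⟩ := this
        rw [← injOn_coord j hy.1 hp hyp]
        exact hy.2
      · have : M.coord j p.1 ∈ O ∩ M.coord j '' M.source j := by
          rw [← hOe]
          exact mem_image_of_mem _ ⟨hp, h⟩
        exact ⟨this.1, trivial⟩
    rw [mem_inter_iff, key, and_comm]
    refine and_congr_right fun hpi => ?_
    have h1 : tCoord M j p ∈ repSet (M := M) (N := M) id j i ×ˢ (univ : Set M.E) :=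
      ⟨mem_image_of_mem _ ⟨hp, hpi⟩, trivial⟩
    rw [tCoord_change hM hp hpi]
    have h2 := Set.ext_iff.1 hVV (tCoord M j p)
    simp only [mem_inter_iff, h1, and_true] at h2
    exact h2.symm

theorem adm_image_tCoord (hM : CnAtlas 1 M) (i : M.ι) :
    Adm (tCoord M i '' {p | p.1 ∈ M.source i}) := by
  rw [image_tCoord hM subset_rfl]
  exact (TopMfd.adm i).prod_univ

theorem TopMfd.T (hM : CnAtlas 1 M) : TopMfd (T M) where
  isTopologicalAddGroup := inferInstanceAs (IsTopologicalAddGroup (M.E × M.E))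
  continuousSMul := inferInstanceAs (ContinuousSMul ℝ (M.E × M.E))
  locallyConvexSpace := inferInstanceAs (LocallyConvexSpace ℝ (M.E × M.E))
  t2Space := inferInstanceAs (T2Space (M.E × M.E))
  mem_source p := TopMfd.mem_source (M := M) p.1
  isOpen_source i := isOpen_T_preimage_fst (TopMfd.isOpen_source (M := M) i)
  isEmbedding i := isEmbedding_tCoord hM i
  adm i := adm_image_tCoord hM i

theorem repSet_tMap {N : Mfd.{w}} (hM : CnAtlas 1 M) (f : M.carrier → N.carrier) (i : M.ι) (j : N.ι) :
    repSet (M := T M) (N := T N) (tMap f) i j = repSet f i j ×ˢ univ :=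
  image_tCoord hM (repDom_subset f i j)

theorem eqOn_rep_tMap (hM : CnAtlas 1 M) (hN : CnAtlas 1 N) {f : M.carrier → N.carrier}
    (hf : IsCn 1 f) (i : M.ι) (j : N.ι) :
    EqOn (rep (M := T M) (N := T N) (tMap f) i j)
      (fun p => (rep f i j p.1, differential (rep f i j) (repSet f i j) p))
      (repSet f i j ×ˢ univ) := by
  have := TopMfd.T hM
  have := TopMfd.T hN
  rw [← repSet_tMap hM]
  rintro _ ⟨p, hp, rfl⟩
  rw [rep_coord hp]
  exact tCoord_tMap hM hN hf hp

theorem continuous_tMap (hM : CnAtlas 1 M) (hN : CnAtlas 1 N) {f : M.carrier → N.carrier}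
    (hf : IsCn 1 f) : Continuous (tMap f) := by
  have := TopMfd.T hM
  have := TopMfd.T hN
  refine continuous_of_continuousOn_rep
    (fun i j => isOpen_T_preimage_fst (isOpen_repDom hf.1 i j)) fun p =>
    ⟨M.chartAt p.1, N.chartAt (f p.1), ⟨TopMfd.mem_source (M := M) _, TopMfd.mem_source (M := N) _⟩,
      ?_⟩
  rw [repSet_tMap hM]
  exact (hf.continuousOn_tRep _ _).congr (eqOn_rep_tMap hM hN hf _ _)

theorem IsCn.tMap (hM : CnAtlas 1 M) (hN : CnAtlas 1 N) {n : ℕ} {f : M.carrier → N.carrier}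
    (hf : IsCn (n + 1) f) : IsCn n (tMap f) := by
  have := TopMfd.T hM
  have := TopMfd.T hN
  have hf1 := hf.of_le (Nat.le_add_left 1 n)
  refine ⟨continuous_tMap hM hN hf1, fun (i : M.ι) (j : N.ι) => ?_⟩
  rw [repSet_tMap hM]
  refine CkOnNat.congr ?_ (eqOn_rep_tMap hM hN hf1 i j).symm
  exact CkOnNat.prodMk (CkOnNat.comp_clm (L := ContinuousLinearMap.fst ℝ M.E M.E)
    (adm_repSet hf.1 i j) (hf.2 i j).of_succ fun p hp => hp.1)
    ((ckOnNat_succ_iff (adm_repSet hf.1 i j)).1 (hf.2 i j)).2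

theorem isCn_succ_iff (hM : CnAtlas 1 M) (hN : CnAtlas 1 N) {n : ℕ} {f : M.carrier → N.carrier} :
    IsCn (n + 1) f ↔ IsCn 1 f ∧ IsCn n (Mfd.tMap f) := by
  have := TopMfd.T hM
  refine ⟨fun hf => ⟨hf.of_le (Nat.le_add_left 1 n), hf.tMap hM hN⟩, fun ⟨hf, hft⟩ =>
    ⟨hf.1, fun i j => (ckOnNat_succ_iff (adm_repSet hf.1 i j)).2 ⟨hf.isC1 i j, ?_⟩⟩⟩
  have h := hft.2 i j
  rw [repSet_tMap hM] at h
  exact (h.congr (eqOn_rep_tMap hM hN hf i j)).snd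

/-- The changes of charts of `TM` represent `T id = id`, so one order of differentiability is lost.
-/
theorem CnAtlas.T {n : ℕ} (hM : CnAtlas (n + 1) M) : CnAtlas n (T M) := by
  have hM1 := hM.of_le (Nat.le_add_left 1 n)
  have h := (hM.isCn_id.tMap hM1 hM1).2
  rwa [tMap_id] at h

end Tangent

/-! ### Products and their tangent bundles -/

section Product

variable {M N : Mfd.{u}} {P : Mfd.{v}} [TopMfd M] [TopMfd N] [TopMfd P]

instance instTopMfdProd : TopMfd (M.prod N) where
  isTopologicalAddGroup := inferInstanceAs (IsTopologicalAddGroup (M.E × N.E))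
  continuousSMul := inferInstanceAs (ContinuousSMul ℝ (M.E × N.E))
  locallyConvexSpace := inferInstanceAs (LocallyConvexSpace ℝ (M.E × N.E))
  t2Space := inferInstanceAs (T2Space (M.E × N.E))
  mem_source x := ⟨TopMfd.mem_source x.1, TopMfd.mem_source x.2⟩
  isOpen_source i := (TopMfd.isOpen_source i.1).prod (TopMfd.isOpen_source i.2)
  isEmbedding i := ((TopMfd.isEmbedding i.1).prodMap (TopMfd.isEmbedding i.2)).comp
    (Homeomorph.Set.prod (M.source i.1) (N.source i.2)).isEmbedding
  adm i := by
    have h := (TopMfd.adm i.1).prod (TopMfd.adm i.2)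
    rwa [prod_image_image_eq] at h

theorem IsCn.prodMk {M N : Mfd.{u}} {n : ℕ} {f : P.carrier → M.carrier} {g : P.carrier → N.carrier}
    (hf : IsCn n f) (hg : IsCn n g) :
    IsCn (M := P) (N := M.prod N) n (fun x => (f x, g x)) := by
  refine ⟨hf.1.prodMk hg.1, fun i jl => ?_⟩
  have h1 : repDom (M := P) (N := M.prod N) (fun x => (f x, g x)) i jl ⊆ repDom f i jl.1 :=
    fun x hx => ⟨hx.1, hx.2.1⟩
  have h2 : repDom (M := P) (N := M.prod N) (fun x => (f x, g x)) i jl ⊆ repDom g i jl.2 :=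
    fun x hx => ⟨hx.1, hx.2.2⟩
  refine (((hf.2 i jl.1).mono (image_mono h1)).prodMk ((hg.2 i jl.2).mono (image_mono h2))).congr ?_
  rintro _ ⟨x, hx, rfl⟩
  simp only [rep_coord hx, rep_coord (h1 hx), rep_coord (h2 hx)]

theorem dRep_prodMk {f : P.carrier → M.carrier} {g : P.carrier → N.carrier}
    (hf : IsCn 1 f) (hg : IsCn 1 g) {i : P.ι} {j : M.ι} {l : N.ι} {x : P.carrier}
    (hx : x ∈ P.source i) (hfx : f x ∈ M.source j) (hgx : g x ∈ N.source l) (v : P.E) :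
    dRep (M := P) (N := M.prod N) (fun x => (f x, g x)) i (j, l) x v =
      (dRep f i j x v, dRep g i l x v) := by
  have h1 : repDom (M := P) (N := M.prod N) (fun x => (f x, g x)) i (j, l) ⊆ repDom f i j :=
    fun x hx => ⟨hx.1, hx.2.1⟩
  have h2 : repDom (M := P) (N := M.prod N) (fun x => (f x, g x)) i (j, l) ⊆ repDom g i l :=
    fun x hx => ⟨hx.1, hx.2.2⟩
  have h3 : IsC1 (rep (M := P) (N := M.prod N) (fun x => (f x, g x)) i (j, l)) _ _ :=
    (((hf.isC1 i j).mono (image_mono h1)).prodMk ((hg.isC1 i l).mono (image_mono h2))).congr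
      (by
        rintro _ ⟨x, hx, rfl⟩
        simp only [rep_coord hx, rep_coord (h1 hx), rep_coord (h2 hx)])
  exact dRep_eq (hf.prodMk hg).1 h3 ⟨hx, hfx, hgx⟩ v

theorem isCn_fst {n : ℕ} (hM : CnAtlas n M) : IsCn (M := M.prod N) (N := M) n Prod.fst := by
  refine ⟨continuous_fst, fun ij l => ?_⟩
  have hm : MapsTo (ContinuousLinearMap.fst ℝ M.E N.E)
      (repSet (M := M.prod N) (N := M) Prod.fst ij l) (repSet (M := M) (N := M) id ij.1 l) := by
    rintro _ ⟨x, hx, rfl⟩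
    exact mem_image_of_mem _ ⟨hx.1.1, hx.2⟩
  refine ((hM ij.1 l).comp_clm (adm_repSet continuous_id ij.1 l) hm).congr ?_
  rintro _ ⟨x, hx, rfl⟩
  rw [rep_coord hx]
  exact rep_coord (f := id) ⟨hx.1.1, hx.2⟩

theorem isCn_snd {n : ℕ} (hN : CnAtlas n N) : IsCn (M := M.prod N) (N := N) n Prod.snd := by
  refine ⟨continuous_snd, fun ij l => ?_⟩
  have hm : MapsTo (ContinuousLinearMap.snd ℝ M.E N.E)
      (repSet (M := M.prod N) (N := N) Prod.snd ij l) (repSet (M := N) (N := N) id ij.2 l) := by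
    rintro _ ⟨x, hx, rfl⟩
    exact mem_image_of_mem _ ⟨hx.1.2, hx.2⟩
  refine ((hN ij.2 l).comp_clm (adm_repSet continuous_id ij.2 l) hm).congr ?_
  rintro _ ⟨x, hx, rfl⟩
  rw [rep_coord hx]
  exact rep_coord (f := id) ⟨hx.1.2, hx.2⟩

theorem dRep_fst (hM : CnAtlas 1 M) {i l : M.ι} {j : N.ι} {x : M.carrier} {y : N.carrier}
    (hx : x ∈ M.source i) (hy : y ∈ N.source j) (hxl : x ∈ M.source l) (v : M.E) (w : N.E) :
    dRep (M := M.prod N) (N := M) Prod.fst (i, j) l (x, y) (v, w) =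
      dRep (M := M) (N := M) id i l x v := by
  have h := isCn_fst (N := N) hM
  have hm : MapsTo (ContinuousLinearMap.fst ℝ M.E N.E)
      (repSet (M := M.prod N) (N := M) Prod.fst (i, j) l) (repSet (M := M) (N := M) id i l) := by
    rintro _ ⟨x, hx, rfl⟩
    exact mem_image_of_mem _ ⟨hx.1.1, hx.2⟩
  have h3 : IsC1 (rep (M := M.prod N) (N := M) Prod.fst (i, j) l) _ _ :=
    ((hM.isCn_id.isC1 i l).comp (isC1_clm (ContinuousLinearMap.fst ℝ M.E N.E) _) hm).congr (by
      rintro _ ⟨x, hx, rfl⟩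
      rw [rep_coord hx]
      exact rep_coord (f := id) ⟨hx.1.1, hx.2⟩)
  exact dRep_eq h.1 h3 ⟨⟨hx, hy⟩, hxl⟩ (v, w)

theorem dRep_snd (hN : CnAtlas 1 N) {i : M.ι} {j l : N.ι} {x : M.carrier} {y : N.carrier}
    (hx : x ∈ M.source i) (hy : y ∈ N.source j) (hyl : y ∈ N.source l) (v : M.E) (w : N.E) :
    dRep (M := M.prod N) (N := N) Prod.snd (i, j) l (x, y) (v, w) =
      dRep (M := N) (N := N) id j l y w := by
  have h := isCn_snd (M := M) hN
  have hm : MapsTo (ContinuousLinearMap.snd ℝ M.E N.E)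
      (repSet (M := M.prod N) (N := N) Prod.snd (i, j) l) (repSet (M := N) (N := N) id j l) := by
    rintro _ ⟨x, hx, rfl⟩
    exact mem_image_of_mem _ ⟨hx.1.2, hx.2⟩
  have h3 : IsC1 (rep (M := M.prod N) (N := N) Prod.snd (i, j) l) _ _ :=
    ((hN.isCn_id.isC1 j l).comp (isC1_clm (ContinuousLinearMap.snd ℝ M.E N.E) _) hm).congr (by
      rintro _ ⟨x, hx, rfl⟩
      rw [rep_coord hx]
      exact rep_coord (f := id) ⟨hx.1.2, hx.2⟩)
  exact dRep_eq h.1 h3 ⟨⟨hx, hy⟩, hyl⟩ (v, w)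

theorem CnAtlas.prod {n : ℕ} (hM : CnAtlas n M) (hN : CnAtlas n N) : CnAtlas n (M.prod N) :=
  ((isCn_fst hM).prodMk (isCn_snd hN)).2

theorem dRep_id_prod (hM : CnAtlas 1 M) (hN : CnAtlas 1 N) {i k : M.ι} {j l : N.ι}
    {x : M.carrier} {y : N.carrier} (hx : x ∈ M.source i) (hy : y ∈ N.source j)
    (hxk : x ∈ M.source k) (hyl : y ∈ N.source l) (v : M.E) (w : N.E) :
    dRep (M := M.prod N) (N := M.prod N) id (i, j) (k, l) (x, y) (v, w) =
      (dRep (M := M) (N := M) id i k x v, dRep (M := N) (N := N) id j l y w) := by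
  rw [← dRep_fst hM hx hy hxk v w, ← dRep_snd hN hx hy hyl v w]
  exact dRep_prodMk (isCn_fst hM) (isCn_snd hN) (x := (x, y)) ⟨hx, hy⟩ hxk hyl (v, w)

/-- The identification of `TM × TN` with `T(M × N)`. -/
def tProd (p : (T M).carrier × (T N).carrier) : (T (M.prod N)).carrier :=
  ((p.1.1, p.2.1), (p.1.2, p.2.2))

theorem tMap_prodMk {f : P.carrier → M.carrier} {g : P.carrier → N.carrier}
    (hf : IsCn 1 f) (hg : IsCn 1 g) (p : (T P).carrier) :
    tMap (M := P) (N := M.prod N) (fun x => (f x, g x)) p = tProd (tMap f p, tMap g p) :=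
  Prod.ext rfl (dRep_prodMk hf hg (TopMfd.mem_source _) (TopMfd.mem_source _)
    (TopMfd.mem_source _) _)

theorem tMap_fst (hM : CnAtlas 1 M) (p : (T M).carrier × (T N).carrier) :
    tMap (M := M.prod N) (N := M) Prod.fst (tProd p) = p.1 :=
  Prod.ext rfl ((dRep_fst hM (TopMfd.mem_source _) (TopMfd.mem_source _)
    (TopMfd.mem_source _) _ _).trans (dRep_id (TopMfd.mem_source _) _))

theorem tMap_snd (hN : CnAtlas 1 N) (p : (T M).carrier × (T N).carrier) :
    tMap (M := M.prod N) (N := N) Prod.snd (tProd p) = p.2 :=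
  Prod.ext rfl ((dRep_snd hN (TopMfd.mem_source _) (TopMfd.mem_source _)
    (TopMfd.mem_source _) _ _).trans (dRep_id (TopMfd.mem_source _) _))

theorem tCoord_tProd (hM : CnAtlas 1 M) (hN : CnAtlas 1 N) {i : M.ι} {j : N.ι}
    {p : (T M).carrier × (T N).carrier} (hi : p.1.1 ∈ M.source i) (hj : p.2.1 ∈ N.source j) :
    tCoord (M.prod N) (i, j) (tProd p) =
      (((tCoord M i p.1).1, (tCoord N j p.2).1), ((tCoord M i p.1).2, (tCoord N j p.2).2)) :=
  Prod.ext rfl (dRep_id_prod hM hN (TopMfd.mem_source _) (TopMfd.mem_source _) hi hj _ _)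

/-- In matching charts, `tProd` is the continuous linear map exchanging the two middle components.
-/
theorem isCn_tProd {n : ℕ} (hM : CnAtlas (n + 1) M) (hN : CnAtlas (n + 1) N) :
    IsCn (M := (T M).prod (T N)) (N := T (M.prod N)) n tProd := by
  have hM1 := hM.of_le (Nat.le_add_left 1 n)
  have hN1 := hN.of_le (Nat.le_add_left 1 n)
  have := TopMfd.T hM1
  have := TopMfd.T hN1
  have := TopMfd.T (hM1.prod hN1)
  refine isCn_of_charts (hM.T.prod hN.T) (hM.prod hN).T (fun (ij : M.ι × N.ι) (kl : M.ι × N.ι) => ?_)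
    fun p => ⟨(M.chartAt p.1.1, N.chartAt p.2.1), (M.chartAt p.1.1, N.chartAt p.2.1),
      ⟨⟨TopMfd.mem_source (M := M) _, TopMfd.mem_source (M := N) _⟩,
        ⟨TopMfd.mem_source (M := M) _, TopMfd.mem_source (M := N) _⟩⟩, ?_⟩
  · have h1 := isOpen_T_preimage_fst ((TopMfd.isOpen_source (M := M) ij.1).inter
      (TopMfd.isOpen_source (M := M) kl.1))
    have h2 := isOpen_T_preimage_fst ((TopMfd.isOpen_source (M := N) ij.2).inter
      (TopMfd.isOpen_source (M := N) kl.2))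
    convert h1.prod h2 using 1
    ext p
    constructor
    · rintro ⟨⟨ha, hb⟩, hc, hd⟩
      exact ⟨⟨ha, hc⟩, hb, hd⟩
    · rintro ⟨⟨ha, hc⟩, hb, hd⟩
      exact ⟨⟨ha, hb⟩, hc, hd⟩
  · let A := M.E × M.E
    let B := N.E × N.E
    let L : (A × B) →L[ℝ] ((M.E × N.E) × (M.E × N.E)) :=
      (((ContinuousLinearMap.fst ℝ M.E M.E).comp (ContinuousLinearMap.fst ℝ A B)).prod
        ((ContinuousLinearMap.fst ℝ N.E N.E).comp (ContinuousLinearMap.snd ℝ A B))).prod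
      (((ContinuousLinearMap.snd ℝ M.E M.E).comp (ContinuousLinearMap.fst ℝ A B)).prod
        ((ContinuousLinearMap.snd ℝ N.E N.E).comp (ContinuousLinearMap.snd ℝ A B)))
    refine CkOnNat.congr (ckOnNat_clm L _) ?_
    rintro _ ⟨q, hq, rfl⟩
    rw [rep_coord hq]
    exact (tCoord_tProd hM1 hN1 hq.1.1 hq.1.2).symm

end Product

/-! ### Constant maps -/

section Const

variable {M : Mfd.{u}} {N : Mfd.{w}} [TopMfd M] [TopMfd N]

theorem isCn_const {N : Mfd.{w}} {n : ℕ} (c : N.carrier) :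
    IsCn (M := M) (N := N) n (fun _ => c) := by
  refine ⟨continuous_const, fun i j => CkOnNat.congr (ckOnNat_const (N.coord j c) _) ?_⟩
  rintro _ ⟨x, hx, rfl⟩
  rw [rep_coord hx]

theorem tMap_const (c : N.carrier) (p : (T M).carrier) :
    tMap (M := M) (N := N) (fun _ => c) p = (c, 0) := by
  refine Prod.ext rfl ?_
  have h := isCn_const (M := M) (N := N) (n := 1) c
  have h' : IsC1 (rep (M := M) (N := N) (fun _ => c) (M.chartAt p.1) (N.chartAt c)) (fun _ => 0)
      (repSet (M := M) (N := N) (fun _ => c) (M.chartAt p.1) (N.chartAt c)) := by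
    refine (isC1_const (N.coord (N.chartAt c) c) _).congr ?_
    rintro _ ⟨x, hx, rfl⟩
    rw [rep_coord hx]
  exact dRep_eq h.1 h' ⟨TopMfd.mem_source _, TopMfd.mem_source _⟩ _

end Const

/-! ### Lie groups and their tangent groups -/

/-- A smooth manifold with a group structure such that the group operations are smooth. -/
class LieMfd (N : Mfd.{w}) extends Group N.carrier where
  topMfd : TopMfd N
  cnAtlas : ∀ n, CnAtlas n N
  isCn_mul : ∀ n, IsCn (M := N.prod N) (N := N) n (fun p => p.1 * p.2)
  isCn_inv : ∀ n, IsCn (M := N) (N := N) n (fun x => x⁻¹)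

attribute [instance] LieMfd.topMfd

section Lie

variable {M : Mfd.{u}} {N : Mfd.{w}} [TopMfd M] [LieMfd N]

instance : IsTopologicalGroup N.carrier where
  continuous_mul := (LieMfd.isCn_mul (N := N) 0).1
  continuous_inv := (LieMfd.isCn_inv (N := N) 0).1

theorem IsCn.mul {n : ℕ} {f g : M.carrier → N.carrier} (hf : IsCn n f) (hg : IsCn n g) :
    IsCn n (f * g) :=
  (LieMfd.isCn_mul n).comp (hf.prodMk hg)

theorem IsCn.inv {n : ℕ} {f : M.carrier → N.carrier} (hf : IsCn n f) : IsCn n f⁻¹ :=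
  (LieMfd.isCn_inv n).comp hf

instance instTopMfdT : TopMfd (T N) := TopMfd.T (LieMfd.cnAtlas 1)

instance instMulT : Mul (T N).carrier :=
  ⟨fun p q => tMap (M := N.prod N) (N := N) (fun p => p.1 * p.2) (tProd (p, q))⟩

instance instInvT : Inv (T N).carrier :=
  ⟨fun p => tMap (M := N) (N := N) (fun x => x⁻¹) p⟩

instance instOneT : One (T N).carrier :=
  ⟨((1 : N.carrier), (0 : N.E))⟩

theorem tMap_mul {f g : M.carrier → N.carrier} (hf : IsCn 1 f) (hg : IsCn 1 g)
    (p : (T M).carrier) : tMap (f * g) p = tMap f p * tMap g p := by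
  have h := congrFun (tMap_comp (LieMfd.isCn_mul (N := N) 1) (hf.prodMk hg)) p
  exact h.trans (congrArg _ (tMap_prodMk hf hg p))

theorem tMap_inv {f : M.carrier → N.carrier} (hf : IsCn 1 f) (p : (T M).carrier) :
    tMap f⁻¹ p = (tMap f p)⁻¹ :=
  congrFun (tMap_comp (LieMfd.isCn_inv (N := N) 1) hf) p

theorem tMap_one (p : (T M).carrier) : tMap (1 : M.carrier → N.carrier) p = 1 :=
  tMap_const 1 p

/-- Associativity in `N` is applied to the three projections of `N × (N × N)`. Taking tangent maps
at a point `x` lying over `p`, `q`, `r` gives the identity in `TN`. The other group axioms come from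
`N` in the same way. -/
theorem T_mul_assoc (p q r : (T N).carrier) : p * q * r = p * (q * r) := by
  have hN : CnAtlas 1 N := LieMfd.cnAtlas 1
  let P := N.prod (N.prod N)
  have : TopMfd P := instTopMfdProd
  let f₁ : P.carrier → N.carrier := Prod.fst
  let f₂ : P.carrier → N.carrier := Prod.fst ∘ Prod.snd
  let f₃ : P.carrier → N.carrier := Prod.snd ∘ Prod.snd
  have h₁ : IsCn 1 f₁ := isCn_fst hN
  have hs : IsCn (M := P) (N := N.prod N) 1 Prod.snd := isCn_snd (hN.prod hN)
  have h₂ : IsCn 1 f₂ := (isCn_fst hN).comp hs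
  have h₃ : IsCn 1 f₃ := (isCn_snd hN).comp hs
  let x : (T P).carrier := tProd (p, tProd (q, r))
  have e₁ : tMap f₁ x = p := tMap_fst hN (p, tProd (q, r))
  have es : tMap (M := P) (N := N.prod N) Prod.snd x = tProd (q, r) :=
    tMap_snd (hN.prod hN) (p, tProd (q, r))
  have e₂ : tMap f₂ x = q := by
    rw [tMap_comp (isCn_fst hN) hs, Function.comp_apply, es]
    exact tMap_fst hN (q, r)
  have e₃ : tMap f₃ x = r := by
    rw [tMap_comp (isCn_snd hN) hs, Function.comp_apply, es]
    exact tMap_snd hN (q, r)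
  have h := congrArg (fun f => tMap f x) (mul_assoc f₁ f₂ f₃)
  simpa only [tMap_mul (h₁.mul h₂) h₃, tMap_mul h₁ (h₂.mul h₃), tMap_mul h₁ h₂, tMap_mul h₂ h₃,
    e₁, e₂, e₃] using h

theorem T_one_mul (p : (T N).carrier) : 1 * p = p := by
  have hi : IsCn (M := N) (N := N) 1 id := (LieMfd.cnAtlas 1).isCn_id
  have h := tMap_mul (isCn_const (M := N) (1 : N.carrier)) hi p
  have h1 : (fun _ => 1 : N.carrier → N.carrier) * id = id := one_mul _
  rw [h1, tMap_id] at h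
  exact ((congrArg (· * p) (tMap_const (1 : N.carrier) p)).symm.trans h.symm)

theorem T_inv_mul (p : (T N).carrier) : p⁻¹ * p = 1 := by
  have hi : IsCn (M := N) (N := N) 1 id := (LieMfd.cnAtlas 1).isCn_id
  have h := tMap_mul hi.inv hi p
  have h1 : (id⁻¹ : N.carrier → N.carrier) * id = 1 := inv_mul_cancel _
  rw [h1, tMap_one, tMap_inv hi, tMap_id] at h
  exact h.symm

instance instGroupT : Group (T N).carrier :=
  Group.ofLeftAxioms T_mul_assoc T_one_mul T_inv_mul

instance instLieMfdT : LieMfd (T N) where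
  topMfd := inferInstance
  cnAtlas n := (LieMfd.cnAtlas (n + 1)).T
  isCn_mul n := by
    have := TopMfd.T ((LieMfd.cnAtlas (N := N) 1).prod (LieMfd.cnAtlas (N := N) 1))
    exact IsCn.comp (N := T (N.prod N))
      ((LieMfd.isCn_mul (n + 1)).tMap ((LieMfd.cnAtlas 1).prod (LieMfd.cnAtlas 1))
        (LieMfd.cnAtlas 1)) (isCn_tProd (LieMfd.cnAtlas (n + 1)) (LieMfd.cnAtlas (n + 1)))
  isCn_inv n := (LieMfd.isCn_inv (n + 1)).tMap (LieMfd.cnAtlas 1) (LieMfd.cnAtlas 1)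

/-- The iterated tangent groups. -/
instance instLieMfdIterT : (j : ℕ) → (N : Mfd.{w}) → [LieMfd N] → LieMfd (iterT j N)
  | 0, _, h => h
  | j + 1, N, _ => instLieMfdIterT j (T N)

/-! ### The structure of the tangent group -/

/-- The tangent vector `v` at the point `x`. -/
def tMk (x : N.carrier) (v : N.E) : (T N).carrier := (x, v)

/-- The bundle projection of the tangent bundle. -/
def tBase (p : (T N).carrier) : N.carrier := p.1

/-- The vector part of an element of the tangent bundle. -/
def tVec (p : (T N).carrier) : N.E := p.2

theorem tMk_base_vec {N : Mfd.{w}} (p : (T N).carrier) : tMk (tBase p) (tVec p) = p := rfl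

theorem tBase_mul (p q : (T N).carrier) : tBase (p * q) = tBase p * tBase q := rfl

theorem tBase_inv (p : (T N).carrier) : tBase p⁻¹ = (tBase p)⁻¹ := rfl

theorem continuous_tBase : Continuous (tBase (N := N)) := continuous_T_fst

/-- Over a fixed pair of base points, multiplication in `TN` is the differential of the
multiplication of `N`, which is additive. -/
theorem tVec_mul_add (x y : N.carrier) (v v' w w' : N.E) :
    tVec (tMk x (v + v') * tMk y (w + w')) =
      tVec (tMk x v * tMk y w) + tVec (tMk x v' * tMk y w') := by
  have h := LieMfd.isCn_mul (N := N) 1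
  exact (h.isC1 _ _).add_deriv (adm_repSet h.1 _ _)
    (coord_mem_repSet (M := N.prod N) (N := N) (x := (x, y))
      ⟨TopMfd.mem_source (M := N.prod N) _, TopMfd.mem_source _⟩) (v, w) (v', w')

theorem tMk_one_zero : tMk (1 : N.carrier) (0 : N.E) = 1 := rfl

theorem tMk_one_add (v w : N.E) :
    tMk (1 : N.carrier) (v + w) = tMk 1 v * tMk 1 w := by
  -- The pair `(v, w)` is split as `(v, 0) + (0, w)`; each summand has the neutral element as one
  -- factor.
  have h := tVec_mul_add (1 : N.carrier) 1 v 0 0 w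
  simp only [add_zero, zero_add, tMk_one_zero, mul_one, one_mul] at h
  rw [← tMk_base_vec (tMk 1 v * tMk 1 w), h, tBase_mul]
  exact congrArg (tMk · (v + w)) (one_mul 1).symm

/-- Differentials vanish in the direction `0`, so a zero vector has vector part `0` in every chart,
not only in the preferred one. -/
theorem continuous_tMk_zero : Continuous (fun x : N.carrier => tMk x (0 : N.E)) := by
  refine continuous_iff_continuousAt.2 fun x => ?_
  have key : ∀ y ∈ N.source (N.chartAt x), tCoord N (N.chartAt x) (tMk y 0) =
      (N.coord (N.chartAt x) y, 0) := fun y hy => by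
    have h : IsCn (M := N) (N := N) 1 id := (LieMfd.cnAtlas 1).isCn_id
    exact Prod.ext rfl ((h.isC1 _ _).deriv_zero (adm_repSet h.1 _ _)
      (coord_mem_repSet (M := N) (N := N) (f := id) ⟨TopMfd.mem_source y, hy⟩))
  have hs := (TopMfd.isOpen_source (N.chartAt x)).mem_nhds (TopMfd.mem_source x)
  refine tendsto_nhds_of_coord (M := T N) (i := N.chartAt x) (TopMfd.mem_source (M := N) x)
    (by filter_upwards [hs] with y hy using hy) ?_
  have h1 : Tendsto (fun y => (N.coord (N.chartAt x) y, (0 : N.E))) (𝓝 x)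
      (𝓝 (N.coord (N.chartAt x) x, 0)) :=
    (continuousAt_coord (TopMfd.mem_source x)).prodMk_nhds tendsto_const_nhds
  rw [← key x (TopMfd.mem_source x)] at h1
  refine h1.congr' ?_
  filter_upwards [hs] with y hy using (key y hy).symm

theorem tCoord_tMk (x : N.carrier) (v : N.E) :
    tCoord N (N.chartAt x) (tMk x v) = (N.coord (N.chartAt x) x, v) :=
  Prod.ext rfl (dRep_id (TopMfd.mem_source x) v)

theorem tendsto_tMk_iff {Z : Type*} {l : Filter Z} {f : Z → N.E} {x : N.carrier} {v : N.E} :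
    Tendsto (fun z => tMk x (f z)) l (𝓝 (tMk x v)) ↔ Tendsto f l (𝓝 v) := by
  have hx : tMk x v ∈ (T N).source (N.chartAt x) := TopMfd.mem_source (M := N) x
  constructor
  · intro h
    have h1 := (continuousAt_coord (M := T N) hx).tendsto.comp h
    have h2 := (continuous_snd (X := N.E) (Y := N.E)).continuousAt.tendsto.comp h1
    refine (h2.congr fun z => ?_).trans_eq ?_
    · exact congrArg Prod.snd (tCoord_tMk x (f z))
    · exact congrArg (fun p => 𝓝 (Prod.snd p)) (tCoord_tMk x v)
  · intro h
    refine tendsto_nhds_of_coord (M := T N) hx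
      (Eventually.of_forall fun z => TopMfd.mem_source (M := N) x) ?_
    have h1 : Tendsto (fun z => (N.coord (N.chartAt x) x, f z)) l
        (𝓝 (N.coord (N.chartAt x) x, v)) := tendsto_const_nhds.prodMk_nhds h
    rw [← tCoord_tMk] at h1
    exact h1.congr fun z => (tCoord_tMk x (f z)).symm

end Lie

end Mfd

/-! ### Completeness -/

/-- Left Cauchy filters converge. -/
def CauchyConverges (G : Type*) [Group G] [TopologicalSpace G] : Prop :=
  ∀ l : Filter G, l.NeBot → Tendsto (fun p : G × G => p.1⁻¹ * p.2) (l ×ˢ l) (𝓝 1) → ∃ x, l ≤ 𝓝 x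

/-- Cauchy filters converge. -/
def AddCauchyConverges (E : Type*) [AddCommGroup E] [TopologicalSpace E] : Prop :=
  ∀ l : Filter E, l.NeBot → Tendsto (fun p : E × E => p.2 - p.1) (l ×ˢ l) (𝓝 0) → ∃ x, l ≤ 𝓝 x

theorem AddCauchyConverges.prod {E F : Type*} [AddCommGroup E] [TopologicalSpace E]
    [AddCommGroup F] [TopologicalSpace F] (hE : AddCauchyConverges E)
    (hF : AddCauchyConverges F) : AddCauchyConverges (E × F) := by
  intro l hl h
  obtain ⟨x, hx⟩ := hE (map Prod.fst l) inferInstance (by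
    rw [prod_map_map_eq, tendsto_map'_iff]
    exact (continuous_fst.tendsto (0 : E × F)).comp h)
  obtain ⟨y, hy⟩ := hF (map Prod.snd l) inferInstance (by
    rw [prod_map_map_eq, tendsto_map'_iff]
    exact (continuous_snd.tendsto (0 : E × F)).comp h)
  exact ⟨(x, y), (Tendsto.prodMk_nhds hx hy : Tendsto id l (𝓝 (x, y)))⟩

namespace Mfd

/-- Every `p` factors as `tMk 1 (u p) * z p`, with `z p` the zero vector at its base point. The base
points converge by completeness of `N`, hence so does `z`; it remains to see that `u` is Cauchy in
the model space. -/
theorem cauchyConverges_T {N : Mfd.{w}} [LieMfd N] (hN : CauchyConverges N.carrier)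
    (hE : AddCauchyConverges N.E) : CauchyConverges (T N).carrier := by
  intro l hl h
  obtain ⟨x, hx⟩ := hN (map tBase l) inferInstance (by
    rw [prod_map_map_eq, tendsto_map'_iff]
    exact ((continuous_tBase (N := N)).tendsto 1).comp h)
  let z : (T N).carrier → (T N).carrier := fun p => tMk (tBase p) 0
  have hz : Tendsto z l (𝓝 (tMk x 0)) := ((continuous_tMk_zero (N := N)).tendsto x).comp hx
  let u : (T N).carrier → N.E := fun p => tVec (p * (z p)⁻¹)
  have hu : ∀ p, tMk 1 (u p) = p * (z p)⁻¹ := fun p => by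
    rw [← tMk_base_vec (p * (z p)⁻¹), tBase_mul, tBase_inv]
    exact congrArg (tMk · (u p)) (mul_inv_cancel (tBase p)).symm
  -- On the fibre over `1`, differences are quotients. As `z` converges and `p⁻¹ * q → 1`, the
  -- right-hand side tends to `1`.
  have hsub : ∀ p q, tMk 1 (u q - u p) = z p * (p⁻¹ * q) * (z q)⁻¹ := fun p q => by
    have h1 := tMk_one_add (u p) (u q - u p)
    rw [add_sub_cancel, hu, hu] at h1
    rw [← inv_mul_eq_iff_eq_mul.2 h1]
    group
  obtain ⟨v, hv⟩ := hE (map u l) inferInstance (by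
    rw [prod_map_map_eq, tendsto_map'_iff]
    refine tendsto_tMk_iff (x := 1).1 ?_
    have h2 := ((hz.comp tendsto_fst).mul h).mul (hz.comp (tendsto_snd (f := l))).inv
    rw [mul_one, mul_inv_cancel] at h2
    exact h2.congr fun p => (hsub p.1 p.2).symm)
  refine ⟨tMk 1 v * tMk x 0, ?_⟩
  have h3 : Tendsto (fun p => tMk 1 (u p) * z p) l (𝓝 (tMk 1 v * tMk x 0)) :=
    (tendsto_tMk_iff.2 hv).mul hz
  exact (h3.congr fun p => by rw [hu, inv_mul_cancel_right, id] : Tendsto id l _)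

theorem cauchyConverges_iterT (j : ℕ) : ∀ (N : Mfd.{w}) [LieMfd N], CauchyConverges N.carrier →
    AddCauchyConverges N.E → CauchyConverges (iterT j N).carrier := by
  induction j with
  | zero => exact fun N _ h _ => h
  | succ j ih =>
    intro N _ h h'
    exact ih (T N) (cauchyConverges_T h h') (h'.prod h')

/-! ### Limits of `C^n`-maps -/

section Limits

variable {M : Mfd.{u}} {N : Mfd.{w}} [TopMfd M] [TopMfd N]

theorem t2Space_T [T2Space N.carrier] (hN : CnAtlas 1 N) : T2Space (T N).carrier := by
  have := TopMfd.T hN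
  refine t2Space_iff_disjoint_nhds.2 fun p q hpq => ?_
  by_cases h : p.1 = q.1
  · have hp : p ∈ (T N).source (N.chartAt p.1) := TopMfd.mem_source (M := N) p.1
    have hq : q ∈ (T N).source (N.chartAt p.1) :=
      (h ▸ TopMfd.mem_source (M := N) p.1 : q.1 ∈ N.source (N.chartAt p.1))
    exact (continuousAt_coord hp).disjoint (disjoint_nhds_nhds.2 fun he =>
      hpq (injOn_coord (M := T N) _ hp hq he)) (continuousAt_coord hq)
  · exact ((continuous_T_fst (M := N)).tendsto p).disjoint (disjoint_nhds_nhds.2 h)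
      ((continuous_T_fst (M := N)).tendsto q)

/-- Over a chart domain `U`, the bundle is `U × E` by means of `θ`, which keeps the base point in
`U` so that local compactness of `M` applies directly. -/
theorem locallyCompactSpace_T [LocallyCompactSpace M.carrier] [LocallyCompactSpace M.E]
    (hM : CnAtlas 1 M) : LocallyCompactSpace (T M).carrier := by
  have := TopMfd.T hM
  refine ⟨fun p n hn => ?_⟩
  let i : M.ι := M.chartAt p.1
  have hp : p ∈ (T M).source i := TopMfd.mem_source (M := M) p.1
  let θ : (T M).source i → M.source i × M.E := fun q => (⟨q.1.1, q.2⟩, (tCoord M i q.1).2)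
  have hθ : Continuous θ := by
    refine Continuous.prodMk ?_ ?_
    · exact ((continuous_T_fst (M := M)).comp continuous_subtype_val).subtype_mk _
    · exact (continuous_snd (X := M.E) (Y := M.E)).comp (isEmbedding_tCoord hM i).continuous
  have hθe : IsEmbedding θ := IsEmbedding.of_comp hθ
    (((TopMfd.isEmbedding i).continuous).prodMap continuous_id) (isEmbedding_tCoord hM i)
  have hθs : Function.Surjective θ := by
    rintro ⟨⟨x, hx⟩, w⟩
    obtain ⟨v, hv⟩ := exists_tCoord_eq hM hx w
    have h : (tCoord M i (x, v)).2 = w := by rw [hv]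
    exact ⟨⟨(x, v), hx⟩, Prod.ext rfl h⟩
  have : LocallyCompactSpace (M.source i) := (TopMfd.isOpen_source i).locallyCompactSpace
  have : LocallyCompactSpace ((T M).source i) :=
    IsOpenEmbedding.locallyCompactSpace (f := θ) ⟨hθe, by rw [hθs.range_eq]; exact isOpen_univ⟩
  have ho : IsOpenEmbedding (Subtype.val : (T M).source i → (T M).carrier) :=
    (TopMfd.isOpen_source (M := T M) i).isOpenEmbedding_subtypeVal
  obtain ⟨s, hs, hsn, hsc⟩ := local_compact_nhds (x := (⟨p, hp⟩ : (T M).source i))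
    (n := Subtype.val ⁻¹' n) (continuous_subtype_val.continuousAt hn)
  exact ⟨Subtype.val '' s, ho.image_mem_nhds.2 hs, image_subset_iff.2 hsn,
    hsc.image continuous_subtype_val⟩

theorem map_coord_nhds {i : M.ι} {x : M.carrier} (hx : x ∈ M.source i)
    (hi : M.coord i x ∈ interior (M.coord i '' M.source i)) :
    map (M.coord i) (𝓝 x) = 𝓝 (M.coord i x) := by
  rw [← (TopMfd.isOpen_source i).nhdsWithin_eq hx, map_coord_nhdsWithin subset_rfl hx,
    nhdsWithin_eq_nhds.2 (mem_interior_iff_mem_nhds.1 hi)]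

/-- Continuous convergence of a family of maps. -/
def ContConv {α X Y : Type*} [TopologicalSpace X] [TopologicalSpace Y] (l : Filter α)
    (F : α → X → Y) (f : X → Y) : Prop :=
  ∀ x, Tendsto (fun p : α × X => F p.1 p.2) (l ×ˢ 𝓝 x) (𝓝 (f x))

theorem ContConv.tendsto {α X Y : Type*} [TopologicalSpace X] [TopologicalSpace Y] {l : Filter α}
    {F : α → X → Y} {f : X → Y} (h : ContConv l F f) (x : X) :
    Tendsto (fun a => F a x) l (𝓝 (f x)) :=
  (h x).comp (tendsto_id.prodMk (tendsto_const_nhds (x := x)))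

variable {α : Type*} {l : Filter α} [l.NeBot] {F : α → M.carrier → N.carrier}
  {f : M.carrier → N.carrier} {g : (T M).carrier → (T N).carrier}

theorem tendsto_prod_of_map_eq {α X Y Z : Type*} {l : Filter α} {lX : Filter X} {lY : Filter Y}
    {lZ : Filter Z} {e : X → Y} {h : α × Y → Z} (he : map e lX = lY)
    (hh : Tendsto (fun q : α × X => h (q.1, e q.2)) (l ×ˢ lX) lZ) : Tendsto h (l ×ˢ lY) lZ := by
  rw [← he, ← map_id (f := l), prod_map_map_eq, tendsto_map'_iff]
  exact hh

theorem fst_eq_of_contConv {M : Mfd.{u}} {F : α → M.carrier → N.carrier}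
    {f : M.carrier → N.carrier} {g : (T M).carrier → (T N).carrier} [T2Space N.carrier] (h : ContConv l F f)
    (h' : ContConv l (fun a => tMap (F a)) g) (p : (T M).carrier) : (g p).1 = f p.1 :=
  tendsto_nhds_unique (((continuous_T_fst (M := N)).tendsto _).comp (h'.tendsto p)) (h.tendsto p.1)

/-- `hasDirDeriv_of_tendsto` applied to the local representatives. Only interior points are treated:
there the chart maps the neighbourhood filter onto the full neighbourhood filter of the model space.
-/
theorem hasDirDeriv_rep_of_contConv (hM : CnAtlas 1 M) (hN : CnAtlas 1 N)
    (hF : ∀ a, IsCn 1 (F a)) (hg : ∀ p, (g p).1 = f p.1)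
    (h : ContConv l F f) (h' : ContConv l (fun a => tMap (F a)) g) {i : M.ι} {j : N.ι}
    {p : (T M).carrier} (hp : p.1 ∈ repDom f i j)
    (hpi : M.coord i p.1 ∈ interior (repSet f i j)) :
    HasDirDeriv (rep f i j) (M.coord i p.1) (tCoord M i p).2 (tCoord N j (g p)).2 := by
  have := TopMfd.T hM
  have := TopMfd.T hN
  have hpi' : M.coord i p.1 ∈ interior (M.coord i '' M.source i) :=
    interior_mono (image_mono (repDom_subset f i j)) hpi
  -- The representatives of `F a` have domains depending on `a`; continuous convergence gives a
  -- common neighbourhood of `p.1` for all late `a`.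
  have hdom : ∀ᶠ q in l ×ˢ 𝓝 p.1, q.2 ∈ repDom (F q.1) i j :=
    (tendsto_snd.eventually ((TopMfd.isOpen_source i).mem_nhds hp.1)).and
      ((h p.1).eventually ((TopMfd.isOpen_source j).mem_nhds hp.2))
  refine hasDirDeriv_of_tendsto (l := l) (f' := fun a => rep (F a) i j)
    (g' := fun a y => differential (rep (F a) i j) (repSet (F a) i j) (y, (tCoord M i p).2))
    ?_ ?_ ?_
  · filter_upwards [mem_interior_iff_mem_nhds.1 hpi]
    rintro _ ⟨x, hx, rfl⟩
    rw [rep_coord hx]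
    have h1 := h.tendsto x
    refine ((continuousAt_coord hx.2).tendsto.comp h1).congr' ?_
    filter_upwards [h1.eventually ((TopMfd.isOpen_source j).mem_nhds hx.2)] with a ha
    exact (rep_coord ⟨hx.1, ha⟩).symm
  · obtain ⟨A, hA, W, hW, hAW⟩ := mem_prod_iff.1 hdom
    have hW' : M.coord i '' W ∈ 𝓝 (M.coord i p.1) := by
      rw [← map_coord_nhds hp.1 hpi']
      exact image_mem_map hW
    filter_upwards [prod_mem_prod hA (interior_mem_nhds.2 hW')]
    rintro ⟨a, y⟩ ⟨ha, hy⟩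
    have hsub : M.coord i '' W ⊆ repSet (F a) i j := image_mono fun x hx => hAW (mk_mem_prod ha hx)
    have hy' := interior_mono hsub hy
    exact (((hF a).isC1 i j).3 y (interior_subset hy') _).hasDirDeriv hy'
  · have h1 : Tendsto (fun q : α × (T M).carrier => (tCoord N j (tMap (F q.1) q.2)).2)
        (l ×ˢ 𝓝 p) (𝓝 (tCoord N j (g p)).2) := by
      have hgp : g p ∈ (T N).source j :=
        (by rw [hg p]; exact hp.2 : (g p).1 ∈ N.source j)
      exact ((continuous_snd (X := N.E) (Y := N.E)).tendsto _).comp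
        ((continuousAt_coord (M := T N) hgp).tendsto.comp (h' p))
    have h2 : Tendsto (fun q : α × (T M).carrier =>
        differential (rep (F q.1) i j) (repSet (F q.1) i j) (tCoord M i q.2)) (l ×ˢ 𝓝 p)
        (𝓝 (tCoord N j (g p)).2) := by
      refine h1.congr' ?_
      filter_upwards [(tendsto_id.prodMap ((continuous_T_fst (M := M)).tendsto p)).eventually hdom]
        with q hq
      exact congrArg Prod.snd (tCoord_tMap hM hN (hF q.1) hq)
    have h3 : map (tCoord M i) (@nhds (T M).carrier _ p) = 𝓝 (tCoord M i p) := by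
      refine map_coord_nhds (M := T M) (i := i) hp.1 ?_
      have h4 : (tCoord M i p) ∈ interior (tCoord M i '' {p | p.1 ∈ M.source i}) := by
        rw [image_tCoord hM subset_rfl, interior_prod_eq]
        exact ⟨hpi', by simp⟩
      exact h4
    have h4 := tendsto_prod_of_map_eq (h := fun q : α × (M.E × M.E) =>
      differential (rep (F q.1) i j) (repSet (F q.1) i j) q.2) h3 h2
    have h5 : Tendsto (fun q : α × M.E => (q.1, (q.2, (tCoord M i p).2)))
        (l ×ˢ 𝓝 (M.coord i p.1)) (l ×ˢ 𝓝 (tCoord M i p)) :=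
      tendsto_fst.prodMk (tendsto_snd.prodMk_nhds tendsto_const_nhds)
    have h6 := h4.comp h5
    simpa only [Function.comp_def] using h6

/-- The limit `g` of the tangent maps covers `f`, and its vector part in charts, `G i j`, is a
continuous candidate for the differential up to the boundary. It is correct at interior points,
which suffices by `isC1_of_hasDirDeriv`. -/
theorem isCn_one_of_contConv [T2Space N.carrier] (hM : CnAtlas 1 M) (hN : CnAtlas 1 N)
    (hF : ∀ a, IsCn 1 (F a)) (hf : Continuous f) (hgc : Continuous g)
    (h : ContConv l F f) (h' : ContConv l (fun a => tMap (F a)) g) :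
    IsCn 1 f ∧ tMap f = g := by
  have := TopMfd.T hM
  have := TopMfd.T hN
  have hg := fst_eq_of_contConv h h'
  have hdom : ∀ (i : M.ι) (j : N.ι), repDom (M := T M) (N := T N) g i j =
      {p | p.1 ∈ repDom f i j} := fun i j => by
    ext p
    exact and_congr_right fun _ => (by rw [hg p] :
      (g p).1 ∈ N.source j ↔ f p.1 ∈ N.source j)
  have hset : ∀ (i : M.ι) (j : N.ι), repSet (M := T M) (N := T N) g i j =
      repSet f i j ×ˢ univ := fun i j => by
    unfold repSet
    rw [hdom]
    exact image_tCoord hM (repDom_subset f i j)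
  let G (i : M.ι) (j : N.ι) : M.E × M.E → N.E := fun q => (rep (M := T M) (N := T N) g i j q).2
  have hG : ∀ (i : M.ι) (j : N.ι) (p : (T M).carrier), p.1 ∈ repDom f i j →
      G i j (tCoord M i p) = (tCoord N j (g p)).2 := fun i j p hp => by
    have hp' : p ∈ repDom (M := T M) (N := T N) g i j := by
      rw [hdom]
      exact hp
    exact congrArg Prod.snd (rep_coord hp')
  have hC1 : ∀ i j, IsC1 (rep f i j) (G i j) (repSet f i j) := fun i j => by
    refine isC1_of_hasDirDeriv (adm_repSet hf i j) ?_ ?_ ?_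
    · refine (continuousOn_image_coord_iff (repDom_subset f i j)).2 ?_
      exact ((continuousOn_coord j).comp hf.continuousOn fun x hx => hx.2).congr
        fun x hx => rep_coord hx
    · rw [← hset]
      refine (continuous_snd (X := N.E) (Y := N.E)).comp_continuousOn
        ((continuousOn_image_coord_iff (repDom_subset (M := T M) (N := T N) g i j)).2 ?_)
      exact ((continuousOn_coord (M := T N) j).comp hgc.continuousOn fun x hx => hx.2).congr
        fun x hx => rep_coord hx
    · intro y hy v
      obtain ⟨x, hx, rfl⟩ := interior_subset hy
      obtain ⟨w, hw⟩ := exists_tCoord_eq hM hx.1 v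
      have h1 := hasDirDeriv_rep_of_contConv hM hN hF hg h h' (p := (x, w)) hx hy
      rw [← hG i j (x, w) hx, hw] at h1
      exact h1
  have hf1 : IsCn 1 f := ⟨hf, fun i j => (hC1 i j).ckOnNat_succ (hC1 i j).2⟩
  refine ⟨hf1, funext fun p => ?_⟩
  have hp : p.1 ∈ repDom f (M.chartAt p.1) (N.chartAt (f p.1)) :=
    ⟨TopMfd.mem_source _, TopMfd.mem_source _⟩
  refine injOn_tCoord hN (N.chartAt (f p.1)) (TopMfd.mem_source (M := N) (f p.1))
    (by rw [← hg p]; exact TopMfd.mem_source (M := N) (g p).1) ?_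
  rw [tCoord_tMap hM hN hf1 hp]
  refine Prod.ext ?_ ?_
  · rw [show (tCoord M (M.chartAt p.1) p).1 = M.coord _ p.1 from rfl, rep_coord hp]
    change N.coord _ (f p.1) = N.coord _ (g p).1
    rw [hg p]
  · rw [← hG _ _ p hp]
    exact (hC1 _ _).differential_eq (adm_repSet hf _ _) ⟨coord_mem_repSet hp, trivial⟩

/-- The first-order result gives `T (g 0) = g 1`; the induction hypothesis is then used for the maps
`tMap (F a)` between `TM` and `TN`, with the shifted family `g (j + 1)`. -/
theorem isCn_of_contConv {α : Type*} {l : Filter α} [l.NeBot] (n : ℕ) :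
    ∀ (M : Mfd.{u}) (N : Mfd.{w}) [TopMfd M] [TopMfd N] [T2Space N.carrier],
    CnAtlas n M → CnAtlas n N → ∀ (F : α → M.carrier → N.carrier)
    (g : ∀ j, (iterT j M).carrier → (iterT j N).carrier), (∀ a, IsCn n (F a)) →
    (∀ j ≤ n, Continuous (g j)) → (∀ j ≤ n, ContConv l (fun a => iterTMap j (F a)) (g j)) →
    IsCn (M := M) (N := N) n (g 0) ∧ ∀ j ≤ n, iterTMap j (M := M) (N := N) (g 0) = g j := by
  induction n with
  | zero =>
    intro M N _ _ _ _ _ F g _ hg _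
    have h0 : Continuous (g 0) := hg 0 le_rfl
    refine ⟨⟨h0, fun i j => ?_⟩, fun j hj => ?_⟩
    · refine (continuousOn_image_coord_iff (repDom_subset _ i j)).2 ?_
      exact ((continuousOn_coord j).comp h0.continuousOn fun x hx => hx.2).congr
        fun x hx => rep_coord hx
    · obtain rfl := Nat.le_zero.1 hj
      rfl
  | succ n ih =>
    intro M N _ _ _ hM hN F g hF hg h
    have hM1 := hM.of_le (Nat.le_add_left 1 n)
    have hN1 := hN.of_le (Nat.le_add_left 1 n)
    have := TopMfd.T hM1
    have := TopMfd.T hN1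
    have := t2Space_T hN1
    obtain ⟨h1, h2⟩ := isCn_one_of_contConv (g := g 1) hM1 hN1
      (fun a => (hF a).of_le (Nat.le_add_left 1 n)) (hg 0 (Nat.zero_le _))
      (hg 1 (Nat.le_add_left 1 n)) (h 0 (Nat.zero_le _)) (h 1 (Nat.le_add_left 1 n))
    obtain ⟨h3, h4⟩ := ih (T M) (T N) hM.T hN.T (fun a => tMap (F a)) (fun j => g (j + 1))
      (fun a => (hF a).tMap hM1 hN1) (fun j hj => hg (j + 1) (Nat.succ_le_succ hj))
      (fun j hj => h (j + 1) (Nat.succ_le_succ hj))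
    have h5 : tMap (M := M) (N := N) (g 0) = g 1 := h2
    refine ⟨(isCn_succ_iff hM1 hN1).2 ⟨h1, by rw [h5]; exact h3⟩, fun j hj => ?_⟩
    cases j with
    | zero => rfl
    | succ j =>
      have h6 := h4 j (Nat.le_of_succ_le_succ hj)
      exact (congrArg (iterTMap j (M := T M) (N := T N)) h5).trans h6

end Limits

end Mfd

/-! ### Groups of continuous maps -/

section ContinuousMaps

theorem isCompleteGroup_iff {G : Type*} [Group G] [TopologicalSpace G] [IsTopologicalGroup G] :
    IsCompleteGroup G ↔ CauchyConverges G := by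
  let : UniformSpace G := IsTopologicalGroup.leftUniformSpace G
  have h : ∀ l : Filter G, l ×ˢ l ≤ uniformity G ↔
      Tendsto (fun p : G × G => p.1⁻¹ * p.2) (l ×ˢ l) (𝓝 1) := fun l => map_le_iff_le_comap.symm
  constructor
  · intro hG l hl hc
    exact hG.complete ⟨hl, (h l).2 hc⟩
  · intro hG
    exact ⟨fun {l} hl => hG l hl.1 ((h l).1 hl.2)⟩

theorem addCauchyConverges_of_completeSpace (E : Type*) [AddCommGroup E] [UniformSpace E]
    [IsUniformAddGroup E] [CompleteSpace E] : AddCauchyConverges E := by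
  intro l hl h
  refine CompleteSpace.complete ⟨hl, ?_⟩
  rw [uniformity_eq_comap_nhds_zero]
  exact map_le_iff_le_comap.1 h

theorem isTopologicalGroup_continuousMap (X G : Type*) [TopologicalSpace X] [LocallyCompactSpace X]
    [Group G] [TopologicalSpace G] [IsTopologicalGroup G] : IsTopologicalGroup C(X, G) where
  continuous_inv := ContinuousMap.continuous_postcomp (⟨fun x => x⁻¹, continuous_inv⟩ : C(G, G))

/-- For the left uniformity of `G`, closeness on `K` means that the pointwise quotient maps `K` into
an identity neighbourhood. So left Cauchy filters are Cauchy for uniform convergence on compact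
sets. -/
theorem cauchyConverges_continuousMap {X G : Type*} [TopologicalSpace X] [LocallyCompactSpace X]
    [Group G] [TopologicalSpace G] [IsTopologicalGroup G] (hG : CauchyConverges G) :
    CauchyConverges C(X, G) := by
  let : UniformSpace G := IsTopologicalGroup.leftUniformSpace G
  have : CompleteSpace G := isCompleteGroup_iff.2 hG
  intro l hl h
  refine CompleteSpace.complete (α := C(X, G)) ⟨hl, ?_⟩
  refine ContinuousMap.hasBasis_compactConvergenceUniformity.ge_iff.2 ?_
  rintro ⟨K, V⟩ ⟨hK, hV⟩
  obtain ⟨U, hU, hUV⟩ := mem_comap.1 (show V ∈ comap (fun p : G × G => p.1⁻¹ * p.2) (𝓝 1) from hV)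
  obtain ⟨O, hOU, hO, h1⟩ := mem_nhds_iff.1 hU
  have h2 : ∀ᶠ f : C(X, G) in 𝓝 1, MapsTo f K O :=
    ContinuousMap.eventually_mapsTo hK hO fun x _ => h1
  filter_upwards [h.eventually h2] with p hp x hx
  exact hUV (hOU (hp hx))

theorem induced_compactOpenTopology (X Y : Type*) [TopologicalSpace X] [TopologicalSpace Y] :
    TopologicalSpace.induced (fun f : C(X, Y) => (f : X → Y)) (Mfd.compactOpenTopology X Y) =
      ContinuousMap.compactOpen := by
  rw [induced_generateFrom_eq]
  unfold ContinuousMap.compactOpen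
  congr 1
  ext S
  constructor
  · rintro ⟨_, ⟨K, hK, U, hU, rfl⟩, rfl⟩
    exact ⟨K, hK, U, hU, rfl⟩
  · rintro ⟨K, hK, U, hU, rfl⟩
    exact ⟨_, ⟨K, hK, U, hU, rfl⟩, rfl⟩

end ContinuousMaps

/-! ### The group `C^k(M, N)` -/

namespace Mfd

section CkGroup

theorem continuous_iterTMap (j : ℕ) : ∀ {M : Mfd.{u}} {N : Mfd.{w}} [TopMfd M] [TopMfd N],
    CnAtlas j M → CnAtlas j N → ∀ {f : M.carrier → N.carrier}, IsCn j f →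
    Continuous (iterTMap j f) := by
  induction j with
  | zero =>
    intro M N _ _ _ _ f hf
    exact hf.1
  | succ j ih =>
    intro M N _ _ hM hN f hf
    have hM1 := hM.of_le (Nat.le_add_left 1 j)
    have hN1 := hN.of_le (Nat.le_add_left 1 j)
    have := TopMfd.T hM1
    have := TopMfd.T hN1
    exact ih hM.T hN.T (hf.tMap hM1 hN1)

theorem iterTMap_mul (j : ℕ) : ∀ {M : Mfd.{u}} {N : Mfd.{w}} [TopMfd M] [LieMfd N],
    CnAtlas j M → ∀ {f g : M.carrier → N.carrier}, IsCn j f → IsCn j g →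
    iterTMap j (f * g) = iterTMap j f * iterTMap j g := by
  induction j with
  | zero =>
    intro M N _ _ _ f g _ _
    rfl
  | succ j ih =>
    intro M N _ _ hM f g hf hg
    have hM1 := hM.of_le (Nat.le_add_left 1 j)
    have hN1 := LieMfd.cnAtlas (N := N) 1
    have := TopMfd.T hM1
    have h := ih (N := T N) hM.T (hf.tMap hM1 hN1) (hg.tMap hM1 hN1)
    refine Eq.trans ?_ h
    exact congrArg (iterTMap j (M := T M) (N := T N)) (funext fun p =>
      tMap_mul (hf.of_le (Nat.le_add_left 1 j)) (hg.of_le (Nat.le_add_left 1 j)) p)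

theorem locallyCompactSpace_iterT (j : ℕ) : ∀ (M : Mfd.{u}) [TopMfd M]
    [LocallyCompactSpace M.carrier] [LocallyCompactSpace M.E], CnAtlas j M →
    LocallyCompactSpace (iterT j M).carrier := by
  induction j with
  | zero => exact fun M _ h _ _ => h
  | succ j ih =>
    intro M _ _ _ hM
    have hM1 := hM.of_le (Nat.le_add_left 1 j)
    have := TopMfd.T hM1
    have := locallyCompactSpace_T hM1
    have : LocallyCompactSpace (T M).E := inferInstanceAs (LocallyCompactSpace (M.E × M.E))
    exact ih (T M) hM.T

variable (k : ℕ∞) (M : Mfd.{u}) (N : Mfd.{w}) [TopMfd M] [LieMfd N]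

/-- The group of `C^k`-maps from `M` to `N`. -/
def ckGroup : Subgroup (M.carrier → N.carrier) where
  carrier := {f | IsCk k f}
  mul_mem' hf hg := isCk_iff.2 fun n hn => (isCk_iff.1 hf n hn).mul (isCk_iff.1 hg n hn)
  one_mem' := isCk_iff.2 fun _ _ => isCn_const 1
  inv_mem' hf := isCk_iff.2 fun n hn => (isCk_iff.1 hf n hn).inv

/-- The compact-open `C^k`-topology. -/
instance instTopologicalSpaceCkGroup : TopologicalSpace (ckGroup k M N) :=
  TopologicalSpace.induced Subtype.val (ckTopology k M N)

variable {k M}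

/-- The homomorphism `f ↦ T^j f`. -/
def iterTHom (hM : ∀ n : ℕ, (n : ℕ∞) ≤ k → CnAtlas n M) (j : ℕ) (hj : (j : ℕ∞) ≤ k) :
    ckGroup k M N →* C((iterT j M).carrier, (iterT j N).carrier) :=
  MonoidHom.mk' (fun f => ⟨iterTMap j f.1, continuous_iterTMap j (hM j hj) (LieMfd.cnAtlas j)
    (isCk_iff.1 f.2 j hj)⟩) fun f g => ContinuousMap.ext fun x =>
      congrFun (iterTMap_mul j (hM j hj) (isCk_iff.1 f.2 j hj) (isCk_iff.1 g.2 j hj)) x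

theorem topology_ckGroup_eq (hM : ∀ n : ℕ, (n : ℕ∞) ≤ k → CnAtlas n M) :
    (inferInstance : TopologicalSpace (ckGroup k M N)) = ⨅ (j : ℕ) (hj : (j : ℕ∞) ≤ k),
      TopologicalSpace.induced (iterTHom N hM j hj) ContinuousMap.compactOpen := by
  change TopologicalSpace.induced Subtype.val (ckTopology k M N) = _
  simp only [ckTopology, induced_iInf, induced_compose, ← induced_compactOpenTopology]
  rfl

theorem isTopologicalGroup_ckGroup [LocallyCompactSpace M.carrier] [LocallyCompactSpace M.E]
    (hM : ∀ n : ℕ, (n : ℕ∞) ≤ k → CnAtlas n M) : IsTopologicalGroup (ckGroup k M N) := by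
  have h := topology_ckGroup_eq N hM
  change (instTopologicalSpaceCkGroup k M N) = _ at h
  rw [h]
  refine topologicalGroup_iInf fun j => topologicalGroup_iInf fun hj => ?_
  have := locallyCompactSpace_iterT j M (hM j hj)
  have := isTopologicalGroup_continuousMap (iterT j M).carrier (iterT j N).carrier
  exact topologicalGroup_induced (iterTHom N hM j hj)

/-- Continuous homomorphisms preserve left Cauchy filters, so every `T^j f` has a limit `g j` along
`l`; the limit theorem identifies it as `T^j (g 0)`. -/
theorem cauchyConverges_ckGroup [LocallyCompactSpace M.carrier] [LocallyCompactSpace M.E]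
    [T2Space N.carrier] (hM : ∀ n : ℕ, (n : ℕ∞) ≤ k → CnAtlas n M)
    (hN : CauchyConverges N.carrier) (hE : AddCauchyConverges N.E) :
    CauchyConverges (ckGroup k M N) := by
  intro l hl h
  have hnhds : ∀ x : ckGroup k M N, 𝓝 x = ⨅ (j : ℕ) (hj : (j : ℕ∞) ≤ k),
      comap (iterTHom N hM j hj) (𝓝 (iterTHom N hM j hj x)) := fun x => by
    have h := topology_ckGroup_eq N hM
    refine (congrArg (fun t => @nhds _ t x) h).trans ?_
    simp only [nhds_iInf, nhds_induced]
  -- The bound on `j` is quantified again inside, so that `g` can be chosen as a family indexed by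
  -- all `j`, with irrelevant values for `j > k`.
  have key : ∀ j : ℕ, (j : ℕ∞) ≤ k → ∃ g : C((iterT j M).carrier, (iterT j N).carrier),
      ∀ hj, Tendsto (iterTHom N hM j hj) l (𝓝 g) := fun j hj => by
    have := locallyCompactSpace_iterT j M (hM j hj)
    obtain ⟨g, hg⟩ := cauchyConverges_continuousMap (X := (iterT j M).carrier)
      (cauchyConverges_iterT j N hN hE) (map (iterTHom N hM j hj) l) inferInstance (by
        rw [prod_map_map_eq, tendsto_map'_iff]
        have h1 : Tendsto (iterTHom N hM j hj) (𝓝 1) (𝓝 (iterTHom N hM j hj 1)) := by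
          rw [hnhds 1]
          exact tendsto_comap.mono_left (iInf₂_le j hj)
        rw [map_one] at h1
        refine (h1.comp h).congr fun p => ?_
        simp)
    exact ⟨g, fun _ => hg⟩
  choose! g hg using key
  -- The map `g 0` does not depend on `n`, so the case `k = ∞` follows from all finite orders.
  have hlim : ∀ n : ℕ, (n : ℕ∞) ≤ k → IsCn (M := M) (N := N) n (g 0) ∧
      ∀ j ≤ n, iterTMap j (M := M) (N := N) (g 0) = g j := fun n hn => by
    have hjk : ∀ j ≤ n, (j : ℕ∞) ≤ k := fun j hj => (Nat.cast_le.2 hj).trans hn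
    refine isCn_of_contConv (l := l) n M N (hM n hn) (LieMfd.cnAtlas n) (fun f => f.1)
      (fun j => g j) (fun f => isCk_iff.1 f.2 n hn) (fun j _ => (g j).continuous)
      fun j hj x => ?_
    have := locallyCompactSpace_iterT j M (hM j (hjk j hj))
    have h1 := hg j (hjk j hj) (hjk j hj)
    -- Evaluation is jointly continuous because `T^j M` is locally compact; this turns compact-open
    -- into continuous convergence.
    exact (ContinuousEval.continuous_eval.tendsto (g j, x)).comp
      ((h1.prodMap (tendsto_id (x := 𝓝 x))).trans nhds_prod_eq.ge)
  refine ⟨⟨g 0, isCk_iff.2 fun n hn => (hlim n hn).1⟩, ?_⟩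
  rw [hnhds]
  refine le_iInf₂ fun j hj => map_le_iff_le_comap.1 ?_
  have h1 : iterTHom N hM j hj ⟨g 0, isCk_iff.2 fun n hn => (hlim n hn).1⟩ = g j :=
    ContinuousMap.ext fun x => congrFun ((hlim j hj).2 j le_rfl) x
  rw [h1]
  exact hg j hj hj

variable (k M) in
theorem exists_ckGroup [LocallyCompactSpace M.carrier] [LocallyCompactSpace M.E]
    [T2Space N.carrier] (hM : ∀ n : ℕ, (n : ℕ∞) ≤ k → CnAtlas n M)
    (hN : CauchyConverges N.carrier) (hE : AddCauchyConverges N.E) :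
    ∃ G : Subgroup (M.carrier → N.carrier), (∀ f : M.carrier → N.carrier, f ∈ G ↔ IsCk k f) ∧
      letI : TopologicalSpace G := TopologicalSpace.induced
        (Subtype.val : G → (M.carrier → N.carrier)) (ckTopology k M N)
      ∃ _ : IsTopologicalGroup G, IsCompleteGroup G := by
  have hG := isTopologicalGroup_ckGroup N hM
  exact ⟨ckGroup k M N, fun f => Iff.rfl, hG,
    (@isCompleteGroup_iff _ _ _ hG).2 (cauchyConverges_ckGroup N hM hN hE)⟩

end CkGroup

end Mfd

/-! ### Manifolds given by charted spaces -/

/-- Connects Fréchet smoothness, used for the atlas of `M`, with the Bastiani notion; the extended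
differential is `fderivWithin` evaluated at a vector. -/
theorem CkOnNat.of_contDiffOn {n : ℕ} : ∀ {E F : Type*} [NormedAddCommGroup E] [NormedSpace ℝ E]
    [NormedAddCommGroup F] [NormedSpace ℝ F] {f : E → F} {s : Set E}, UniqueDiffOn ℝ s →
    ContDiffOn ℝ n f s → CkOnNat n f s := by
  induction n with
  | zero => exact fun _ hf => hf.continuousOn
  | succ n ih =>
    intro E F _ _ _ _ f s hs hf
    have hf' : ContDiffOn ℝ ((n : WithTop ℕ∞) + 1) f s := by exact_mod_cast hf
    obtain ⟨hd, -, hn⟩ := (contDiffOn_succ_iff_fderivWithin hs).1 hf'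
    refine ⟨hf.continuousOn, fun p => fderivWithin ℝ f s p.1 p.2, fun x hx v => ?_,
      ih (hs.prod uniqueDiffOn_univ) ?_⟩
    · have h1 := ((hd x (interior_subset hx)).hasFDerivWithinAt.hasFDerivAt
        (mem_interior_iff_mem_nhds.1 hx)).hasLineDerivAt v
      have h2 := hasDerivAt_iff_tendsto_slope_zero.1 h1
      simpa [HasDirDeriv] using h2
    · exact (hn.comp contDiffOn_fst fun p hp => hp.1).clm_apply contDiffOn_snd

theorem Adm.uniqueDiffOn {E : Type*} [NormedAddCommGroup E] [NormedSpace ℝ E] {s : Set E}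
    (hs : Adm s) : UniqueDiffOn ℝ s := by
  obtain ⟨O, C, hO, hC, hCi, rfl⟩ := hs
  rw [inter_comm]
  exact (uniqueDiffOn_convex hC hCi).inter hO

namespace Mfd

/-- Chart images are relatively open in `range I`, which is convex with non-empty interior; hence
they are admissible. -/
theorem topMfd_ofCharted {E : Type u} [AddCommGroup E] [Module ℝ E] [TopologicalSpace E]
    [IsTopologicalAddGroup E] [ContinuousSMul ℝ E] [LocallyConvexSpace ℝ E] [T2Space E]
    {Q : Type u} [TopologicalSpace Q] {I : Q → E} (hI : IsEmbedding I) (hc : Convex ℝ (range I))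
    (hi : (interior (range I)).Nonempty) (M : Type u) [TopologicalSpace M] [ChartedSpace Q M] :
    TopMfd (ofCharted E I M) where
  isTopologicalAddGroup := inferInstance
  continuousSMul := inferInstance
  locallyConvexSpace := inferInstance
  t2Space := inferInstance
  mem_source x := mem_chart_source Q x
  isOpen_source e := e.1.open_source
  isEmbedding e := hI.comp e.1.isOpenEmbedding_restrict.isEmbedding
  adm e := by
    have h : (fun x => I (e.1 x)) '' e.1.source = I '' e.1.target := by
      rw [← e.1.image_source_eq_target, image_image]
    obtain ⟨O, hO, hOe⟩ := hI.isInducing.isOpen_iff.1 e.1.open_target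
    refine ⟨O, range I, hO, hc, hi, h.trans ?_⟩
    rw [← hOe, image_preimage_eq_inter_range]

theorem cnAtlas_ofCharted {n : ℕ} {E : Type u} [NormedAddCommGroup E] [NormedSpace ℝ E]
    {Q : Type u} [TopologicalSpace Q] (I : ModelWithCorners ℝ E Q)
    {M : Type u} [TopologicalSpace M] [ChartedSpace Q M] [IsManifold I n M] :
    CnAtlas n (ofCharted E I M) := by
  have := topMfd_ofCharted I.isClosedEmbedding.isEmbedding I.convex_range I.nonempty_interior M
  intro e e'
  have hcomp : e.1.symm.trans e'.1 ∈ contDiffGroupoid n I := HasGroupoid.compatible e.2 e'.2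
  have h1 : ContDiffOn ℝ n (I ∘ (e.1.symm.trans e'.1) ∘ I.symm)
      (I.symm ⁻¹' (e.1.symm.trans e'.1).source ∩ range I) :=
    (mem_groupoid_of_pregroupoid.1 hcomp).1
  have hs : repSet (M := ofCharted E I M) (N := ofCharted E I M) id e e' ⊆
      I.symm ⁻¹' (e.1.symm.trans e'.1).source ∩ range I := by
    rintro _ ⟨x, ⟨hx, hx'⟩, rfl⟩
    refine ⟨?_, mem_range_self _⟩
    have hx' : x ∈ e'.1.source := hx'
    simp [e.1.left_inv hx, e.1.map_source hx, hx']
  refine (CkOnNat.of_contDiffOn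
    (adm_repSet (M := ofCharted E I M) (N := ofCharted E I M) continuous_id e e').uniqueDiffOn
    (h1.mono hs)).congr ?_
  rintro _ ⟨x, hx, rfl⟩
  rw [rep_coord hx]
  have hx1 : x ∈ e.1.source := hx.1
  simp [e.1.left_inv hx1]

/-- The smooth group structure on a Lie group. -/
@[reducible]
def lieMfdOfIsLieGroup {F : Type w} [AddCommGroup F] [Module ℝ F] [TopologicalSpace F]
    [IsTopologicalAddGroup F] [ContinuousSMul ℝ F] [LocallyConvexSpace ℝ F] [T2Space F]
    {H : Type w} [hg : Group H] [TopologicalSpace H] [ChartedSpace F H] (h : IsLieGroup F H) :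
    LieMfd (ofCharted F id H) where
  toGroup := hg
  topMfd := topMfd_ofCharted IsEmbedding.id (by simpa using convex_univ) (by simp) H
  cnAtlas n i j := h.smooth_atlas i j n le_top
  isCn_mul n := isCk_iff.1 h.smooth_mul n le_top
  isCn_inv n := isCk_iff.1 h.smooth_inv n le_top

end Mfd
end LCCalculus

end

/-! ### Completeness of `C^k(M, H)` -/

theorem mainTheorem6 (k : ℕ∞)
    {E : Type u} [NormedAddCommGroup E] [NormedSpace ℝ E] [FiniteDimensional ℝ E]
    {Q : Type u} [TopologicalSpace Q] (I : ModelWithCorners ℝ E Q)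
    {M : Type u} [TopologicalSpace M] [T2Space M] [ChartedSpace Q M]
    [IsManifold I (k : WithTop ℕ∞) M]
    {F : Type w} [AddCommGroup F] [Module ℝ F] [UniformSpace F] [IsUniformAddGroup F]
    [ContinuousSMul ℝ F] [LocallyConvexSpace ℝ F] [T2Space F] [CompleteSpace F]
    {H : Type w} [Group H] [TopologicalSpace H] [T2Space H] [IsTopologicalGroup H]
    [ChartedSpace F H] (hLie : LCCalculus.IsLieGroup F H)
    (hH : LCCalculus.IsCompleteGroup H) :
    ∃ G : Subgroup (M → H),
      (∀ f : M → H, f ∈ G ↔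
        LCCalculus.Mfd.IsCk (M := LCCalculus.Mfd.ofCharted E I M)
          (N := LCCalculus.Mfd.ofCharted F id H) k f) ∧
      letI : TopologicalSpace G := TopologicalSpace.induced (Subtype.val : G → (M → H))
        (LCCalculus.Mfd.ckTopology k (LCCalculus.Mfd.ofCharted E I M)
          (LCCalculus.Mfd.ofCharted F id H))
      ∃ _ : IsTopologicalGroup G, LCCalculus.IsCompleteGroup G := by
  have := LCCalculus.Mfd.topMfd_ofCharted I.isClosedEmbedding.isEmbedding I.convex_range
    I.nonempty_interior M
  let := LCCalculus.Mfd.lieMfdOfIsLieGroup hLie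
  have hM : ∀ n : ℕ, (n : ℕ∞) ≤ k →
      LCCalculus.Mfd.CnAtlas n (LCCalculus.Mfd.ofCharted E I M) := fun n hn => by
    have : IsManifold I (n : WithTop ℕ∞) M :=
      IsManifold.of_le (n := (k : WithTop ℕ∞)) (by exact_mod_cast hn)
    exact LCCalculus.Mfd.cnAtlas_ofCharted I
  have : LocallyCompactSpace (LCCalculus.Mfd.ofCharted E I M).carrier :=
    Manifold.locallyCompact_of_finiteDimensional (M := M) I
  have : LocallyCompactSpace (LCCalculus.Mfd.ofCharted E I M).E :=
    have := FiniteDimensional.proper ℝ E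
    inferInstanceAs (LocallyCompactSpace E)
  exact LCCalculus.Mfd.exists_ckGroup k (LCCalculus.Mfd.ofCharted E I M)
    (LCCalculus.Mfd.ofCharted F id H) hM (LCCalculus.isCompleteGroup_iff.1 hH)
    (LCCalculus.addCauchyConverges_of_completeSpace F)
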